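/- Let $\mathbb{K}$ be a field of characteristic $0$. All words are finite words on the positive integers. A word $w$ of length $n$ is a *parking function* if for every $1\le i\le n$ at least $i$ of its letters are $\le i$; it is *prime* if moreover its nondecreasing rearrangement $u'_1\le\dots\le u'_n$ satisfies $u'_i<i$ for $2\le i\le n$ (the empty word $\epsilon$ is a prime parking function). The *parkization* $\mathrm{Park}(w)$ of a word $w$ of length $n$ is the parking function obtained as follows: let $d(w)=\min\{i : |\{j: w_j\le i\}|<i\}$; if $d(w)=n+1$ return $w$, otherwise decrease by one all letters greater than $d(w)$ and repeat. Let $\mathbf{PQSym}^*$ be the $\mathbb{K}$-vector space with basis $(\mathbf{G}_u)$ indexed by all parking functions, graded by the length of $u$, with product and coproduct $$\mathbf{G}_u\mathbf{G}_v=\sum_{\substack{w=a\cdot b\ \text{parking function}\\ \mathrm{Park}(a)=u,\ \mathrm{Park}(b)=v}}\mathbf{G}_w,\qquad \Delta\mathbf{G}_u=\sum_{(a,b)\,:\,u\in a\Cup b}\mathbf{G}_a\otimes\mathbf{G}_b ,$$ unit $\mathbf{G}_\epsilon$, and counit the coefficient of $\mathbf{G}_\epsilon$. Here $\cdot$ is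 concatenation, $a,b$ in the second sum are parking functions, and $a\Cup b$ is the set of shuffles of $a$ with the word obtained from $b$ by adding $|a|$ to all letters. One realizes $\mathbf{PQSym}^*$ by (infinite) sums of words via $\mathbf{G}_u=\sum_{w:\,\mathrm{Park}(w)=u}w$. Let $\mathrm{BW}$ be the set of infinite sequences of columns $(L_j,M_j)_{j\ge1}$ such that, for some $n$, the non-empty $L_j$ form an ordered set partition of $\{1,\dots,n\}$, and each $M_j$ is a prime parking function of length $|L_j|$. Words are identified with elements of $\mathrm{BW}$: $(L_j,M_j)_j$ encodes the word of length $n$ whose letters at the positions in $L_j$, from left to right, are those of $M_j$ all increased by $\sum_{p<j}\max(1,|L_p|)$. For $r\in(\mathbb{N}\setminus\{0\})\cup\{\infty\}$, the *$r$-parking quasi-symmetrizing action* is the action of the infinite symmetric group on $\mathrm{BW}$ (hence on words, and linearly on sums of words) in which the elementary transposition $s_i=(i,i+1)$ swaps the $i$-th and $(i+1)$-st columns if at least one of $|L_i|,|L_{i+1}|$ is strictly less than $r$, and does nothing otherwise. Let ${\mathbf{PQSym}^*}^r$ be the subspace of the elements of $\mathbf{PQSym}^*$ that are invariant under this action. **Theorem.**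 With the structure above, $\mathbf{PQSym}^*$ is a graded Hopf algebra, and $$\mathbf{PQSym}^*={\mathbf{PQSym}^*}^1\supseteq{\mathbf{PQSym}^*}^2\supseteq\dots\supseteq{\mathbf{PQSym}^*}^r\supseteq\dots\supseteq{\mathbf{PQSym}^*}^\infty .$$ For every $r\in(\mathbb{N}\setminus\{0\})\cup\{\infty\}$, ${\mathbf{PQSym}^*}^r$ is a graded Hopf subalgebra of $\mathbf{PQSym}^*$ (a graded subspace that contains the unit and is stable under product, coproduct and antipode), and it is noncommutative. It is noncocommutative for every finite $r$, while ${\mathbf{PQSym}^*}^\infty$ is cocommutative. -/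

import Mathlib

open scoped TensorProduct

namespace PQSym

/-! ### Words and parking functions -/

/-- The number of letters of `w` that are at most `i`. -/
def countLE (w : List ℕ) (i : ℕ) : ℕ := w.countP (fun a => decide (a ≤ i))

/-- Finite words on the alphabet of positive integers. -/
abbrev Word : Type := {w : List ℕ // ∀ a ∈ w, 1 ≤ a}

/-- A parking function of length `n` is a word on positive integers having, for every
`1 ≤ i ≤ n`, at least `i` letters that are at most `i`. -/
def IsParking (w : List ℕ) : Prop :=
  (∀ a ∈ w, 1 ≤ a) ∧ ∀ i, 1 ≤ i → i ≤ w.length → i ≤ countLE w i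

/-- A prime parking function is a parking function whose nondecreasing rearrangement
`u'₁ ≤ ⋯ ≤ u'ₙ` satisfies `u'ᵢ < i` for `2 ≤ i ≤ n`. As `u'ᵢ₊₁ ≤ i` means that at least `i + 1`
letters are at most `i`, this is the condition below. -/
def IsPrimeParking (w : List ℕ) : Prop :=
  IsParking w ∧ ∀ i, 1 ≤ i → i + 1 ≤ w.length → i + 1 ≤ countLE w i

/-- The set of all parking functions (of all lengths). -/
abbrev ParkingFunction : Type := {w : List ℕ // IsParking w}

/-- The empty parking function. -/
def emptyPF : ParkingFunction :=
  ⟨[], by simp, fun i h1 h2 => by simp at h2; omega⟩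

/-! ### Parkization -/

theorem exists_gap (w : List ℕ) : ∃ i, countLE w i < i :=
  ⟨w.length + 1, Nat.lt_succ_of_le List.countP_le_length⟩

/-- `d(w) = min {i : |{j : w_j ≤ i}| < i}`. -/
def gap (w : List ℕ) : ℕ := Nat.find (exists_gap w)

/-- Decrement by one all the letters greater than `d(w)`. -/
def parkStep (w : List ℕ) : List ℕ := w.map (fun a => if gap w < a then a - 1 else a)

theorem gap_spec (w : List ℕ) : countLE w (gap w) < gap w := Nat.find_spec (exists_gap w)

theorem one_le_gap (w : List ℕ) : 1 ≤ gap w := by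
  have := gap_spec w
  omega

theorem gap_le (w : List ℕ) : gap w ≤ w.length + 1 :=
  Nat.find_min' _ (Nat.lt_succ_of_le List.countP_le_length)

theorem parkStep_sum_lt {w : List ℕ} (h : gap w ≠ w.length + 1) :
    (parkStep w).sum < w.sum := by
  have h1 := gap_spec w
  have h2 := gap_le w
  have h3 : countLE w (gap w) < w.length := by omega
  have h4 : ∃ a ∈ w, gap w < a := by
    by_contra hc
    push Not at hc
    have : countLE w (gap w) = w.length := by
      unfold countLE
      rw [List.countP_eq_length]
      intro a ha
      simpa using hc a ha
    omega
  obtain ⟨a, ha, hlt⟩ := h4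
  unfold parkStep
  conv_rhs => rw [← List.map_id w]
  refine List.sum_lt_sum _ _ (fun b _ => ?_) ⟨a, ha, ?_⟩
  · simp only [id]
    split_ifs <;> omega
  · simp only [id]
    rw [if_pos hlt]
    omega

/-- The parkization algorithm: if `d(w) = |w| + 1` return `w`, otherwise decrement all the letters
greater than `d(w)` and start again. -/
def parkList (w : List ℕ) : List ℕ :=
  if _h : gap w = w.length + 1 then w else parkList (parkStep w)
termination_by w.sum
decreasing_by exact parkStep_sum_lt _h

theorem isParking_parkList (w : List ℕ) (hw : ∀ a ∈ w, 1 ≤ a) : IsParking (parkList w) := by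
  induction w using parkList.induct with
  | case1 w h =>
    rw [parkList, dif_pos h]
    refine ⟨hw, fun i _ hi => ?_⟩
    have : ¬ countLE w i < i := Nat.find_min (exists_gap w) (show i < gap w by omega)
    omega
  | case2 w h ih =>
    rw [parkList, dif_neg h]
    refine ih (fun a ha => ?_)
    obtain ⟨b, hb, rfl⟩ := List.mem_map.1 ha
    have h1 := hw b hb
    have h2 := one_le_gap w
    split_ifs <;> omega

/-- The parkization `Park(w)` of a word on positive integers. -/
def park (w : Word) : ParkingFunction := ⟨parkList w.1, isParking_parkList w.1 w.2⟩

/-! ### Shifted shuffles -/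

/-- `IsShuffle u v w`: the word `w` occurs in the shuffle of `u` and `v`. -/
inductive IsShuffle : List ℕ → List ℕ → List ℕ → Prop
  | nil : IsShuffle [] [] []
  | left (a : ℕ) {u v w : List ℕ} : IsShuffle u v w → IsShuffle (a :: u) v (a :: w)
  | right (a : ℕ) {u v w : List ℕ} : IsShuffle u v w → IsShuffle u (a :: v) (a :: w)

/-- `w` occurs in the shifted shuffle of `u` and `v`. For parking functions `u` and `v` the shifted
shuffle is multiplicity-free, so it is identified with the set of these `w`. -/
def IsShiftedShuffle (u v w : List ℕ) : Prop := IsShuffle u (v.map (· + u.length)) w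

/-! ### The vector space, product and coproduct -/

theorem finite_parking (n : ℕ) : {u : ParkingFunction | u.1.length = n}.Finite := by
  have hf : {l : List (Fin (n + 1)) | l.length = n}.Finite := List.finite_length_eq _ n
  refine Set.Finite.of_finite_image (f := Subtype.val)
    ((hf.image (List.map Fin.val)).subset ?_) Subtype.val_injective.injOn
  rintro _ ⟨u, hu, rfl⟩
  have hu' : u.1.length = n := hu
  have hle : ∀ a ∈ u.1, a ≤ n := by
    intro a ha
    have hpos : 0 < u.1.length := List.length_pos_of_mem ha
    have h := u.2.2 u.1.length hpos le_rfl
    have h' : countLE u.1 u.1.length = u.1.length := le_antisymm List.countP_le_length h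
    unfold countLE at h'
    rw [List.countP_eq_length] at h'
    have := h' a ha
    simp only [decide_eq_true_eq] at this
    omega
  refine ⟨u.1.map (fun a => Fin.ofNat (n + 1) a), by simpa using hu', ?_⟩
  rw [List.map_map]
  conv_rhs => rw [← List.map_id u.1]
  refine List.map_congr_left (fun a ha => ?_)
  have := hle a ha
  simp only [Function.comp, Fin.ofNat, id]
  exact Nat.mod_eq_of_lt (by omega)

/-- The finite set of parking functions of length `n`. -/
noncomputable def parkingOfLength (n : ℕ) : Finset ParkingFunction := (finite_parking n).toFinset

/-- The underlying vector space of `PQSym*`: finite linear combinations of parking functions. -/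
def PQSymDual (K : Type*) [Field K] : Type _ := ParkingFunction →₀ K

noncomputable instance (K : Type*) [Field K] : AddCommGroup (PQSymDual K) :=
  inferInstanceAs (AddCommGroup (ParkingFunction →₀ K))

noncomputable instance (K : Type*) [Field K] : Module K (PQSymDual K) :=
  inferInstanceAs (Module K (ParkingFunction →₀ K))

/-- The basis `(G_u)`, indexed by parking functions. -/
noncomputable def G (K : Type*) [Field K] : Module.Basis ParkingFunction K (PQSymDual K) :=
  ⟨LinearEquiv.refl K (ParkingFunction →₀ K)⟩

open Classical in
/-- `G_u G_v = ∑ G_w` over the parking functions `w` that are a concatenation `w = a · b` with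
`Park(a) = u` and `Park(b) = v`. Such `w` have length `|u| + |v|`. -/
noncomputable def mulMap (K : Type*) [Field K] :
    PQSymDual K →ₗ[K] PQSymDual K →ₗ[K] PQSymDual K :=
  (G K).constr K fun u => (G K).constr K fun v =>
    ∑ w ∈ (parkingOfLength (u.1.length + v.1.length)).filter
      (fun w => ∃ a b : Word, w.1 = a.1 ++ b.1 ∧ park a = u ∧ park b = v), G K w

noncomputable instance (K : Type*) [Field K] : Mul (PQSymDual K) := ⟨fun x y => mulMap K x y⟩

noncomputable instance (K : Type*) [Field K] : One (PQSymDual K) := ⟨G K emptyPF⟩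

open Classical in
/-- `Δ G_u = ∑ G_a ⊗ G_b` over the pairs of parking functions `(a, b)` such that `u` is in the
shifted shuffle of `a` and `b` (so that `|a| + |b| = |u|`); the counit is the coefficient of
`G_ε`, where `ε` is the empty word. -/
noncomputable instance (K : Type*) [Field K] : CoalgebraStruct K (PQSymDual K) where
  comul := (G K).constr K fun u =>
    ∑ ij ∈ Finset.HasAntidiagonal.antidiagonal u.1.length,
      ∑ ab ∈ (parkingOfLength ij.1 ×ˢ parkingOfLength ij.2).filter
        (fun ab => IsShiftedShuffle ab.1.1 ab.2.1 u.1), G K ab.1 ⊗ₜ[K] G K ab.2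
  counit := (G K).coord emptyPF

/-- The homogeneous component of degree `n`, spanned by the `G_u` with `u` of length `n`. -/
noncomputable def homogeneous (K : Type*) [Field K] (n : ℕ) : Submodule K (PQSymDual K) :=
  Submodule.span K (G K '' {u | u.1.length = n})

/-- The realization of `PQSym*` by (infinite) sums of words on positive integers,
`G_u ↦ ∑_{Park(w) = u} w`: the coefficient of the word `w` in the realization of `x` is the
coefficient of `G_{Park(w)}` in `x`. -/
noncomputable def wordCoeff {K : Type*} [Field K] (x : PQSymDual K) (w : Word) : K :=
  (G K).repr x (park w)

/-! ### Bi-words -/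

/-- The set `BW` of infinite two-row arrays with columns `(L_j, M_j)`, `j ∈ ℕ`, such that the
non-empty `L_j` form a set composition of an `n`-element set of positions and `M_j` is a prime
parking function of length `|L_j|`. Columns and positions are numbered from `0`, so the set of
positions `[n]` is `{0, …, n - 1}`. -/
@[ext]
structure BiWord where
  /-- the length -/
  n : ℕ
  /-- the first row -/
  L : ℕ → Finset ℕ
  /-- the second row -/
  M : ℕ → List ℕ
  disjoint : ∀ i j, i ≠ j → Disjoint (L i) (L j)
  cover : ∀ p, (∃ j, p ∈ L j) ↔ p < n
  prime : ∀ j, IsPrimeParking (M j)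
  length_eq : ∀ j, (M j).length = (L j).card

namespace BiWord

theorem rank_lt (m : BiWord) {p j : ℕ} (h : p ∈ m.L j) :
    ((m.L j).filter (· < p)).card < (m.M j).length := by
  rw [m.length_eq]
  refine Finset.card_lt_card (Finset.filter_ssubset.2 ⟨p, h, by simp⟩)

/-- The index of the column containing the position `p`. -/
def col (m : BiWord) (p : Fin m.n) : ℕ := Nat.find ((m.cover p).2 p.2)

theorem mem_col (m : BiWord) (p : Fin m.n) : (p : ℕ) ∈ m.L (m.col p) :=
  Nat.find_spec ((m.cover p).2 p.2)

/-- The letter at position `p` of the word encoded by `m`: if `p` is in the column `j`, it is the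
letter of `M_j` matching `p`, incremented by `∑_{q < j} |L_q|`, where empty columns count for `1`. -/
def letter (m : BiWord) (p : Fin m.n) : ℕ :=
  (m.M (m.col p))[((m.L (m.col p)).filter (· < (p : ℕ))).card]'(m.rank_lt (m.mem_col p)) +
    ∑ q ∈ Finset.range (m.col p), max 1 (m.L q).card

/-- The word on positive integers encoded by a bi-word. -/
def toWord (m : BiWord) : Word :=
  ⟨List.ofFn m.letter, by
    intro a ha
    obtain ⟨p, rfl⟩ := (List.mem_ofFn' _ _).1 ha
    exact le_add_right ((m.prime _).1.1 _ (List.getElem_mem _))⟩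

/-- Exchange of the columns `i` and `i + 1`. -/
def exchange (i : ℕ) (m : BiWord) : BiWord where
  n := m.n
  L := fun j => m.L (Equiv.swap i (i + 1) j)
  M := fun j => m.M (Equiv.swap i (i + 1) j)
  disjoint := fun _ _ h => m.disjoint _ _ ((Equiv.swap i (i + 1)).injective.ne h)
  cover := fun p => by
    rw [← m.cover p]
    exact ((Equiv.swap i (i + 1)).surjective.exists (p := fun j => p ∈ m.L j)).symm
  prime := fun j => m.prime _
  length_eq := fun j => m.length_eq _

/-- The operator `s_i` of the `r`-action: it swaps the columns `i` and `i + 1` if one of them has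
words of length strictly smaller than `r`, and does nothing otherwise. -/
def step (r : ℕ∞) (i : ℕ) (m : BiWord) : BiWord :=
  open Classical in
  if ((m.L i).card : ℕ∞) < r ∨ ((m.L (i + 1)).card : ℕ∞) < r then m.exchange i else m

theorem step_involutive (r : ℕ∞) (i : ℕ) : Function.Involutive (step r i) := by
  intro m
  have hex : (m.exchange i).exchange i = m := by
    ext1 <;> simp [exchange]
  by_cases h : ((m.L i).card : ℕ∞) < r ∨ ((m.L (i + 1)).card : ℕ∞) < r
  · have h1 : step r i m = m.exchange i := if_pos h
    have h2 : (((m.exchange i).L i).card : ℕ∞) < r ∨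
        (((m.exchange i).L (i + 1)).card : ℕ∞) < r := by
      simpa [exchange] using h.symm
    rw [h1]
    exact (if_pos h2).trans hex
  · have h1 : step r i m = m := if_neg h
    rw [h1, h1]

/-- The elementary transposition `s_i` in the `r`-action, as a permutation of `BW`. -/
noncomputable def simpleRefl (r : ℕ∞) (i : ℕ) : Equiv.Perm BiWord := (step_involutive r i).toPerm

/-- The group of permutations of `BW` through which the infinite symmetric group acts by the
`r`-parking quasi-symmetrizing action: it is generated by the elementary transpositions. -/
def actionGroup (r : ℕ∞) : Subgroup (Equiv.Perm BiWord) :=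
  Subgroup.closure (Set.range (simpleRefl r))

end BiWord

/-- The subspace of the elements of `PQSym*` whose realization as a sum of words, that is of
bi-words, is invariant under the `r`-parking quasi-symmetrizing action. -/
noncomputable def invariants (K : Type*) [Field K] (r : ℕ∞) : Submodule K (PQSymDual K) where
  carrier := {x | ∀ g ∈ BiWord.actionGroup r, ∀ m : BiWord,
    wordCoeff x (g m).toWord = wordCoeff x m.toWord}
  zero_mem' := fun g _ m => by simp [wordCoeff]
  add_mem' := fun {x y} hx hy g hg m => by
    have h1 := hx g hg m
    have h2 := hy g hg m
    simp only [wordCoeff] at h1 h2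
    simp [wordCoeff, h1, h2]
  smul_mem' := fun c x hx g hg m => by
    have h1 := hx g hg m
    simp only [wordCoeff] at h1
    simp [wordCoeff, h1]

/-! ### Graded Hopf algebras and graded Hopf subalgebras -/

section Hopf

universe u v

variable (K : Type u) {A : Type v} [Field K] [AddCommGroup A] [Module K A] [Mul A] [One A]
  [CoalgebraStruct K A]

/-- The vector space `A`, with its given product, unit, coproduct and counit, is a Hopf algebra
with antipode `S`: these data are those of a Hopf algebra `H`, transported by a linear
isomorphism. -/
def IsHopfAlgebra (S : A →ₗ[K] A) : Prop :=
  ∃ (H : Type v) (_ : Ring H) (_ : HopfAlgebra K H) (e : A ≃ₗ[K] H),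
    (∀ x y, e (x * y) = e x * e y) ∧
    e 1 = 1 ∧
    (∀ x, TensorProduct.map e.toLinearMap e.toLinearMap (CoalgebraStruct.comul (R := K) x) =
      CoalgebraStruct.comul (R := K) (e x)) ∧
    (∀ x, CoalgebraStruct.counit (R := K) x = CoalgebraStruct.counit (R := K) (e x)) ∧
    ∀ x, e (S x) = HopfAlgebra.antipode K (e x)

/-- The decomposition `A = ⨁ 𝒜 n` is compatible with the product, unit, coproduct, counit and
antipode. -/
structure IsHopfGrading (𝒜 : ℕ → Submodule K A) (S : A →ₗ[K] A) : Prop where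
  isInternal : DirectSum.IsInternal 𝒜
  one_mem : (1 : A) ∈ 𝒜 0
  mul_mem : ∀ i j, ∀ x ∈ 𝒜 i, ∀ y ∈ 𝒜 j, x * y ∈ 𝒜 (i + j)
  comul_mem : ∀ n, ∀ x ∈ 𝒜 n, CoalgebraStruct.comul (R := K) x ∈
    ⨆ ij ∈ Finset.HasAntidiagonal.antidiagonal n, LinearMap.range (TensorProduct.mapIncl (𝒜 ij.1) (𝒜 ij.2))
  counit_eq_zero : ∀ n, n ≠ 0 → ∀ x ∈ 𝒜 n, CoalgebraStruct.counit (R := K) x = 0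
  antipode_mem : ∀ n, ∀ x ∈ 𝒜 n, S x ∈ 𝒜 n

/-- The subspace `B` is a graded Hopf subalgebra of the graded Hopf algebra `A`. -/
structure IsGradedHopfSubalgebra (𝒜 : ℕ → Submodule K A) (S : A →ₗ[K] A)
    (B : Submodule K A) : Prop where
  one_mem : (1 : A) ∈ B
  mul_mem : ∀ x ∈ B, ∀ y ∈ B, x * y ∈ B
  comul_mem : ∀ x ∈ B, CoalgebraStruct.comul (R := K) x ∈
    LinearMap.range (TensorProduct.mapIncl B B)
  antipode_mem : ∀ x ∈ B, S x ∈ B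
  graded : B = ⨆ n, B ⊓ 𝒜 n

end Hopf

end PQSym

/-!
A word is read as a list of preferences of cars on a one-way street, each car taking the first free
spot from the one it prefers; parkization removes the spots that stay free. It has a closed formula
(`slot`, `parkList_eq_map_slot`), from which it follows that it commutes with the restriction of a
word to a subset of its positions (`parkList_restrict_parkList`) and that it is computed separately
on two groups of cars when the first one fits in an initial segment of the street and the second one
is moved beyond it (`parkList_of_isShuffle`).

The coefficients of the words in the realization of an element of `PQSym*` give functionals `ev l`,
one for each word `l`. In these terms the product is the concatenation product (`ev_mul`), and the
coproduct is given by sums over shuffles (`ev₂_comul`). The axioms of a bialgebra are therefore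
associativity of concatenation and of shuffles, and their compatibility (`shuffleSum_splitSum`). The
bialgebra is graded and connected, and the antipode is the convolution inverse of the identity,
given by a geometric series that is finite in each degree.

The invariants of the `r`-action have a description by words that does not mention columns
(`mem_invariants_iff`): they are the elements whose realization is unchanged when one exchanges two
adjacent segments of the street in which the cars preferring them can be parked separately, provided
that one of the segments has fewer than `r` cars (`IsSwapInvariant`). Indeed such a segment is a
sequence of columns, so that this exchange is a composition of exchanges of adjacent columns, one
from each segment. The condition is inherited by prefixes and suffixes of a word, whence the
stability under the product. It is also compatible with shifted shuffles, so that the coproduct of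
an invariant has all its slices in the space `B` of invariants; over a field it then belongs to
`B ⊗ B`. For `r = ∞` the two segments occupied by the factors of a shifted shuffle may be exchanged,
which gives cocommutativity. For `r = 1` one of the exchanged segments is empty, and the exchange
does not change the parkization.

For each `r`, the elements `G_1` and `G_11` are invariant and do not commute. If `r` is finite, the
parking function with the columns `1ʳ` and `1ʳ⁺¹` gives an invariant basis element whose coproduct
is not symmetric.
-/

namespace PQSym

/-! ### Parkization by a closed formula -/

theorem countLE_append (l l' : List ℕ) (i : ℕ) : countLE (l ++ l') i = countLE l i + countLE l' i :=
  List.countP_append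

theorem countLE_cons (a : ℕ) (l : List ℕ) (i : ℕ) :
    countLE (a :: l) i = countLE l i + if a ≤ i then 1 else 0 := by
  simp [countLE, List.countP_cons]

theorem countLE_mono (l : List ℕ) {i j : ℕ} (h : i ≤ j) : countLE l i ≤ countLE l j :=
  List.countP_mono_left fun a _ ha => by simp at ha ⊢; omega

theorem countLE_lt_of_mem {l : List ℕ} {i j : ℕ} {a : ℕ} (ha : a ∈ l) (h1 : i < a) (h2 : a ≤ j) :
    countLE l i < countLE l j := by
  induction l with
  | nil => simp at ha
  | cons b l ih =>
    rw [countLE_cons, countLE_cons]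
    have h := countLE_mono l (show i ≤ j by omega)
    rcases List.mem_cons.1 ha with rfl | ha
    · rw [if_neg (by omega), if_pos h2]; omega
    · have := ih ha
      split_ifs <;> omega

theorem countLE_eq_length {l : List ℕ} {i : ℕ} (h : ∀ a ∈ l, a ≤ i) : countLE l i = l.length := by
  unfold countLE
  rw [List.countP_eq_length]
  simpa using h

theorem countLE_eq_zero {l : List ℕ} {i : ℕ} (h : ∀ a ∈ l, i < a) : countLE l i = 0 := by
  unfold countLE
  rw [List.countP_eq_zero]
  simpa using h

theorem countLE_le_length (l : List ℕ) (i : ℕ) : countLE l i ≤ l.length := List.countP_le_length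

theorem countLE_map (l : List ℕ) (f : ℕ → ℕ) (i j : ℕ) (h : ∀ a ∈ l, f a ≤ i ↔ a ≤ j) :
    countLE (l.map f) i = countLE l j := by
  unfold countLE
  rw [List.countP_map]
  exact List.countP_congr fun a ha => by simpa using h a ha

/-- The value of a letter `v` of `l` after parkization: the parkization of `l` replaces every
letter `v` by `slot l v`. Unfolded, `slot l v` is the minimum of `v` and of the numbers
`countLE l j + v - j` for `j < v`. -/
def slot (l : List ℕ) : ℕ → ℕ
  | 0 => 0
  | v + 1 => min (slot l v) (countLE l v) + 1

@[simp] theorem slot_zero (l : List ℕ) : slot l 0 = 0 := rfl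

theorem slot_succ (l : List ℕ) (v : ℕ) : slot l (v + 1) = min (slot l v) (countLE l v) + 1 := rfl

theorem slot_le (l : List ℕ) (v : ℕ) : slot l v ≤ v := by
  induction v with
  | zero => simp
  | succ v ih => rw [slot_succ]; omega

theorem one_le_slot (l : List ℕ) {v : ℕ} (h : 1 ≤ v) : 1 ≤ slot l v := by
  obtain ⟨v, rfl⟩ := Nat.exists_eq_add_of_le' h
  rw [slot_succ]; omega

theorem slot_eq_self {l : List ℕ} {n : ℕ} (h : ∀ j < n, j ≤ countLE l j) {v : ℕ} (hv : v ≤ n) :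
    slot l v = v := by
  induction v with
  | zero => rfl
  | succ v ih => rw [slot_succ, ih (by omega), min_eq_left (h v (by omega))]

theorem slot_le_countLE_add (l : List ℕ) {j v : ℕ} (h : j < v) :
    slot l v + j ≤ countLE l j + v := by
  induction v with
  | zero => omega
  | succ v ih =>
    rw [slot_succ]
    rcases Nat.lt_succ_iff_lt_or_eq.1 h with h | rfl
    · have := ih h; omega
    · omega

theorem le_slot {l : List ℕ} {k v : ℕ} (hv : k ≤ v) (h : ∀ j < v, k + j ≤ countLE l j + v) :
    k ≤ slot l v := by
  induction v generalizing k with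
  | zero => omega
  | succ v ih =>
    rw [slot_succ]
    have h1 := h v (by omega)
    have h2 : k - 1 ≤ slot l v := by
      rcases Nat.eq_zero_or_pos k with rfl | hk
      · omega
      · refine ih (by omega) fun j hj => ?_
        have := h j (by omega)
        omega
    omega

theorem slot_congr {l l' : List ℕ} {v : ℕ} (h : ∀ j < v, countLE l j = countLE l' j) :
    slot l v = slot l' v := by
  induction v with
  | zero => rfl
  | succ v ih => rw [slot_succ, slot_succ, ih fun j hj => h j (by omega), h v (by omega)]

theorem slot_mono (l : List ℕ) : Monotone (slot l) := by
  refine monotone_nat_of_le_succ fun v => ?_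
  induction v with
  | zero => simp
  | succ v ih =>
    rw [slot_succ l (v + 1), slot_succ l v]
    have := countLE_mono l (show v ≤ v + 1 by omega)
    rw [slot_succ] at ih
    omega

/-- Distinct letters stay distinct, and in the same order, under parkization. -/
theorem slot_lt_slot {l : List ℕ} {v w : ℕ} (hv : v ∈ l) (hv1 : 1 ≤ v) (h : v < w) :
    slot l v < slot l w := by
  refine lt_of_lt_of_le ?_ (slot_mono l (show v + 1 ≤ w by omega))
  obtain ⟨v, rfl⟩ := Nat.exists_eq_add_of_le' hv1
  have h1 := countLE_lt_of_mem hv (show v < v + 1 by omega) le_rfl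
  rw [slot_succ l (v + 1)]
  rw [slot_succ]
  omega

/-- Decrement all the letters greater than `d`. -/
def dec (d a : ℕ) : ℕ := if d < a then a - 1 else a

/-- The spot `d` stays free when the cars with preferences `l` are parked. -/
def IsFree (l : List ℕ) (d : ℕ) : Prop := countLE l d < slot l d

theorem IsFree.iff_forall {l : List ℕ} {d : ℕ} :
    IsFree l d ↔ countLE l d < d ∧ ∀ j < d, countLE l d + j < countLE l j + d := by
  constructor
  · intro h
    refine ⟨lt_of_lt_of_le h (slot_le l d), fun j hj => ?_⟩
    have := slot_le_countLE_add l hj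
    have h : countLE l d < slot l d := h
    omega
  · rintro ⟨h1, h2⟩
    exact le_slot (k := countLE l d + 1) h1 fun j hj => by have := h2 j hj; omega

/-- Closing a spot that stays free does not change the parkized letters. -/
theorem IsFree.slot_map_dec {l : List ℕ} {d : ℕ} (h : IsFree l d) {a : ℕ} (ha : a ∈ l) :
    slot (l.map (dec d)) (dec d a) = slot l a := by
  obtain ⟨h1, h2⟩ := IsFree.iff_forall.1 h
  obtain ⟨e, rfl⟩ : ∃ e, d = e + 1 := ⟨d - 1, by omega⟩
  have hcount : countLE l e = countLE l (e + 1) := by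
    have := h2 e (by omega)
    have := countLE_mono l (show e ≤ e + 1 by omega)
    omega
  have hnot : ∀ a ∈ l, a ≠ e + 1 := by
    rintro a ha rfl
    have := countLE_lt_of_mem ha (show e < e + 1 by omega) le_rfl
    omega
  have hlow : ∀ j ≤ e, countLE (l.map (dec (e + 1))) j = countLE l j := fun j hj =>
    countLE_map _ _ _ _ fun a _ => by unfold dec; split_ifs <;> omega
  have hhigh : ∀ j, e + 1 ≤ j → countLE (l.map (dec (e + 1))) j = countLE l (j + 1) := fun j hj =>
    countLE_map _ _ _ _ fun a _ => by unfold dec; split_ifs <;> omega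
  have hs : ∀ v ≤ e + 1, slot (l.map (dec (e + 1))) v = slot l v := fun v hv =>
    slot_congr fun j hj => hlow j (by omega)
  have hs' : ∀ v, e + 1 ≤ v → slot (l.map (dec (e + 1))) v = slot l (v + 1) := by
    intro v hv
    induction v, hv using Nat.le_induction with
    | base =>
      rw [hs _ le_rfl, slot_succ l (e + 1)]
      have h3 : countLE l (e + 1) < slot l (e + 1) := h
      rw [slot_succ] at h3 ⊢
      omega
    | succ v hv ih => rw [slot_succ, slot_succ l (v + 1), ih, hhigh v hv]
  have := hnot a ha
  unfold dec
  split_ifs with hlt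
  · obtain ⟨v, rfl⟩ : ∃ v, a = v + 1 := ⟨a - 1, by omega⟩
    exact hs' v (by omega)
  · exact hs a (by omega)

theorem isFree_gap {l : List ℕ} : IsFree l (gap l) := by
  have h := gap_spec l
  have : slot l (gap l) = gap l := slot_eq_self (n := gap l) (fun j hj => by
    have : ¬ countLE l j < j := Nat.find_min (exists_gap l) hj
    omega) le_rfl
  unfold IsFree
  omega

theorem parkStep_eq (l : List ℕ) : parkStep l = l.map (dec (gap l)) := rfl

/-- The parkization algorithm computes `slot`, since the gap that it closes at each step is a spot
that stays free. -/
theorem parkList_eq_map_slot (l : List ℕ) : parkList l = l.map (slot l) := by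
  induction l using parkList.induct with
  | case1 w h =>
    rw [parkList, dif_pos h]
    have hc : ∀ j < w.length + 1, j ≤ countLE w j := fun j hj => by
      have : ¬ countLE w j < j := Nat.find_min (exists_gap w) (show j < gap w by omega)
      omega
    symm
    conv_rhs => rw [← List.map_id w]
    refine List.map_congr_left fun a ha => slot_eq_self hc ?_
    by_contra hlt
    have h1 := countLE_lt_of_mem ha (show w.length < a by omega) le_rfl
    have h2 := hc w.length (by omega)
    have := countLE_le_length w a
    omega
  | case2 w h ih =>
    rw [parkList, dif_neg h, ih, parkStep_eq, List.map_map]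
    exact List.map_congr_left fun a ha => isFree_gap.slot_map_dec ha

theorem IsFree.parkList_map_dec {l : List ℕ} {d : ℕ} (h : IsFree l d) :
    parkList (l.map (dec d)) = parkList l := by
  rw [parkList_eq_map_slot, parkList_eq_map_slot, List.map_map]
  exact List.map_congr_left fun a ha => h.slot_map_dec ha

theorem countLE_add_le_of_sublist {l l' : List ℕ} (h : l.Sublist l') {i j : ℕ} (hij : i ≤ j) :
    countLE l j + countLE l' i ≤ countLE l' j + countLE l i := by
  induction h with
  | slnil => simp [countLE]
  | @cons l₁ l₂ a _ ih =>
    rw [countLE_cons, countLE_cons]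
    split_ifs <;> omega
  | @cons_cons l₁ l₂ a _ ih =>
    simp only [countLE_cons]
    split_ifs <;> omega

theorem countLE_le_of_sublist {l l' : List ℕ} (h : l.Sublist l') (i : ℕ) :
    countLE l i ≤ countLE l' i := h.countP_le

theorem IsFree.of_sublist {l l' : List ℕ} (h : l.Sublist l') {d : ℕ} (hd : IsFree l' d) :
    IsFree l d := by
  rw [IsFree.iff_forall] at hd ⊢
  refine ⟨lt_of_le_of_lt (countLE_le_of_sublist h d) hd.1, fun j hj => ?_⟩
  have := countLE_add_le_of_sublist h (show j ≤ d by omega)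
  have := hd.2 j hj
  omega

/-- Parkization is compatible with the restriction to a subset of the positions. Here the
restriction is any operation on words that commutes with relabelling the letters. -/
theorem parkList_restrict_parkList (R : List ℕ → List ℕ) (hR : ∀ l, (R l).Sublist l)
    (hmap : ∀ (f : ℕ → ℕ) l, R (l.map f) = (R l).map f) (l : List ℕ) :
    parkList (R (parkList l)) = parkList (R l) := by
  induction l using parkList.induct with
  | case1 w h => rw [show parkList w = w by rw [parkList, dif_pos h]]
  | case2 w h ih =>
    rw [show parkList w = parkList (parkStep w) by rw [parkList, dif_neg h], ih, parkStep_eq, hmap]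
    exact (isFree_gap.of_sublist (hR w)).parkList_map_dec

theorem parkList_take_parkList (k : ℕ) (l : List ℕ) :
    parkList ((parkList l).take k) = parkList (l.take k) :=
  parkList_restrict_parkList (List.take k) (List.take_sublist k) (fun _ _ => List.map_take.symm) l

theorem parkList_drop_parkList (k : ℕ) (l : List ℕ) :
    parkList ((parkList l).drop k) = parkList (l.drop k) :=
  parkList_restrict_parkList (List.drop k) (List.drop_sublist k) (fun _ _ => List.map_drop.symm) l

@[simp] theorem length_parkList (l : List ℕ) : (parkList l).length = l.length := by
  rw [parkList_eq_map_slot, List.length_map]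

theorem IsParking.le_countLE {l : List ℕ} (h : IsParking l) {i : ℕ} (hi : i ≤ l.length) :
    i ≤ countLE l i := by
  rcases Nat.eq_zero_or_pos i with rfl | h0
  · omega
  · exact h.2 i h0 hi

theorem IsParking.le_length {l : List ℕ} (h : IsParking l) {a : ℕ} (ha : a ∈ l) : a ≤ l.length := by
  by_contra hlt
  have h1 := countLE_lt_of_mem ha (show l.length < a by omega) le_rfl
  have h2 := h.le_countLE le_rfl
  have := countLE_le_length l a
  omega

theorem IsParking.slot_eq {l : List ℕ} (h : IsParking l) {a : ℕ} (ha : a ≤ l.length) :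
    slot l a = a :=
  slot_eq_self (n := l.length) (fun _ hj => h.le_countLE hj.le) ha

theorem IsParking.parkList_eq {l : List ℕ} (h : IsParking l) : parkList l = l := by
  rw [parkList_eq_map_slot]
  conv_rhs => rw [← List.map_id l]
  exact List.map_congr_left fun a ha => h.slot_eq (h.le_length ha)

theorem isParking_parkList_iff {l : List ℕ} : IsParking (parkList l) ↔ ∀ a ∈ l, 1 ≤ a := by
  refine ⟨fun h a ha => ?_, isParking_parkList l⟩
  by_contra h0
  obtain rfl : a = 0 := by omega
  have : slot l 0 ∈ parkList l := by
    rw [parkList_eq_map_slot]; exact List.mem_map_of_mem ha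
  have := h.1 _ this
  simp at this

/-! ### Sums over shuffles and over splittings of a word -/

section Sums

variable {M N : Type*} [AddCommMonoid M] [AddCommMonoid N]

/-- The sum of `F w` over the words `w` in the shuffle of `u` and `v`, with multiplicities. -/
def shuffleSum (F : List ℕ → M) : List ℕ → List ℕ → M
  | [], v => F v
  | a :: u, [] => F (a :: u)
  | a :: u, b :: v =>
    shuffleSum (fun w => F (a :: w)) u (b :: v) + shuffleSum (fun w => F (b :: w)) (a :: u) v
termination_by u v => u.length + v.length

/-- The sum of `F p q` over the factorizations `l = p · q` of a word. -/
def splitSum (F : List ℕ → List ℕ → M) : List ℕ → M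
  | [] => F [] []
  | a :: l => F [] (a :: l) + splitSum (fun p q => F (a :: p) q) l

@[simp] theorem shuffleSum_nil_left (F : List ℕ → M) (v : List ℕ) : shuffleSum F [] v = F v := by
  rw [shuffleSum]

@[simp] theorem shuffleSum_nil_right (F : List ℕ → M) (u : List ℕ) : shuffleSum F u [] = F u := by
  cases u <;> rw [shuffleSum]

theorem shuffleSum_cons_cons (F : List ℕ → M) (a b : ℕ) (u v : List ℕ) :
    shuffleSum F (a :: u) (b :: v) =
      shuffleSum (fun w => F (a :: w)) u (b :: v) +
        shuffleSum (fun w => F (b :: w)) (a :: u) v := by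
  rw [shuffleSum]

@[simp] theorem splitSum_nil (F : List ℕ → List ℕ → M) : splitSum F [] = F [] [] := rfl

theorem splitSum_cons (F : List ℕ → List ℕ → M) (a : ℕ) (l : List ℕ) :
    splitSum F (a :: l) = F [] (a :: l) + splitSum (fun p q => F (a :: p) q) l := rfl

theorem splitSum_eq_sum_range (F : List ℕ → List ℕ → M) (l : List ℕ) :
    splitSum F l = ∑ k ∈ Finset.range (l.length + 1), F (l.take k) (l.drop k) := by
  induction l generalizing F with
  | nil => simp
  | cons a l ih =>
    rw [splitSum_cons, ih, List.length_cons, Finset.sum_range_succ' _ (l.length + 1), add_comm]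
    rfl

theorem splitSum_congr {F F' : List ℕ → List ℕ → M} {l : List ℕ}
    (h : ∀ k, F (l.take k) (l.drop k) = F' (l.take k) (l.drop k)) :
    splitSum F l = splitSum F' l := by
  rw [splitSum_eq_sum_range, splitSum_eq_sum_range]
  exact Finset.sum_congr rfl fun k _ => h k

theorem splitSum_add (F F' : List ℕ → List ℕ → M) (l : List ℕ) :
    splitSum (fun p q => F p q + F' p q) l = splitSum F l + splitSum F' l := by
  simp only [splitSum_eq_sum_range, Finset.sum_add_distrib]

theorem splitSum_zero (l : List ℕ) : splitSum (fun _ _ => (0 : M)) l = 0 := by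
  simp [splitSum_eq_sum_range]

theorem splitSum_map (F : List ℕ → List ℕ → M) (f : ℕ → ℕ) (l : List ℕ) :
    splitSum F (l.map f) = splitSum (fun p q => F (p.map f) (q.map f)) l := by
  simp [splitSum_eq_sum_range, List.map_take, List.map_drop]

theorem map_splitSum {G : Type*} [FunLike G M N] [AddMonoidHomClass G M N] (φ : G)
    (F : List ℕ → List ℕ → M) (l : List ℕ) :
    φ (splitSum F l) = splitSum (fun p q => φ (F p q)) l := by
  simp [splitSum_eq_sum_range]

/-- Factorizations of a word into three factors. -/
theorem splitSum_splitSum (F : List ℕ → List ℕ → List ℕ → M) (l : List ℕ) :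
    splitSum (fun p q => splitSum (fun p' q' => F p' q' q) p) l =
      splitSum (fun p q => splitSum (fun p' q' => F p p' q') q) l := by
  induction l generalizing F with
  | nil => simp
  | cons a l ih => simp only [splitSum_cons, splitSum_nil, splitSum_add, ih, add_assoc]

/-- Induction along the recursive description of shuffles. -/
theorem shuffle_induction {P : List ℕ → List ℕ → Prop} (nil_left : ∀ v, P [] v)
    (nil_right : ∀ a u, P (a :: u) [])
    (cons_cons : ∀ a u b v, P u (b :: v) → P (a :: u) v → P (a :: u) (b :: v)) : ∀ u v, P u v
  | [], v => nil_left v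
  | a :: u, [] => nil_right a u
  | a :: u, b :: v => cons_cons a u b v (shuffle_induction nil_left nil_right cons_cons u (b :: v))
      (shuffle_induction nil_left nil_right cons_cons (a :: u) v)
termination_by u v => u.length + v.length

theorem shuffleSum_add (F F' : List ℕ → M) (u v : List ℕ) :
    shuffleSum (fun w => F w + F' w) u v = shuffleSum F u v + shuffleSum F' u v := by
  induction u, v using shuffle_induction generalizing F F' with
  | nil_left v => simp
  | nil_right a u => simp
  | cons_cons a u b v ih1 ih2 =>
    simp only [shuffleSum_cons_cons, ih1, ih2]
    exact add_add_add_comm _ _ _ _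

theorem shuffleSum_zero (u v : List ℕ) : shuffleSum (fun _ => (0 : M)) u v = 0 := by
  induction u, v using shuffle_induction with
  | nil_left v => simp
  | nil_right a u => simp
  | cons_cons a u b v ih1 ih2 => simp only [shuffleSum_cons_cons, ih1, ih2, add_zero]

theorem map_shuffleSum {G : Type*} [FunLike G M N] [AddMonoidHomClass G M N] (φ : G)
    (F : List ℕ → M) (u v : List ℕ) : φ (shuffleSum F u v) = shuffleSum (fun w => φ (F w)) u v := by
  induction u, v using shuffle_induction generalizing F with
  | nil_left v => simp
  | nil_right a u => simp
  | cons_cons a u b v ih1 ih2 => simp only [shuffleSum_cons_cons, map_add, ih1, ih2]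

theorem shuffleSum_map (F : List ℕ → M) (f : ℕ → ℕ) (u v : List ℕ) :
    shuffleSum F (u.map f) (v.map f) = shuffleSum (fun w => F (w.map f)) u v := by
  induction u, v using shuffle_induction generalizing F with
  | nil_left v => simp
  | nil_right a u => simp
  | cons_cons a u b v ih1 ih2 =>
    simp only [List.map_cons, shuffleSum_cons_cons] at ih1 ih2 ⊢
    rw [ih1, ih2]

theorem shuffleSum_comm (F : List ℕ → M) (u v : List ℕ) :
    shuffleSum F u v = shuffleSum F v u := by
  induction u, v using shuffle_induction generalizing F with
  | nil_left v => simp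
  | nil_right a u => simp
  | cons_cons a u b v ih1 ih2 => rw [shuffleSum_cons_cons, shuffleSum_cons_cons, ih1, ih2, add_comm]

theorem shuffleSum_congr {F F' : List ℕ → M} {u v : List ℕ}
    (h : ∀ w, IsShuffle u v w → F w = F' w) : shuffleSum F u v = shuffleSum F' u v := by
  have hl : ∀ v, IsShuffle [] v v := fun v => by
    induction v with
    | nil => exact .nil
    | cons a v ih => exact .right a ih
  have hr : ∀ u, IsShuffle u [] u := fun u => by
    induction u with
    | nil => exact .nil
    | cons a u ih => exact .left a ih
  induction u, v using shuffle_induction generalizing F F' with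
  | nil_left v => simpa using h v (hl v)
  | nil_right a u => simpa using h _ (hr _)
  | cons_cons a u b v ih1 ih2 =>
    rw [shuffleSum_cons_cons, shuffleSum_cons_cons, ih1 fun w hw => h _ (.left a hw),
      ih2 fun w hw => h _ (.right b hw)]

theorem shuffleSum_assoc (F : List ℕ → M) (u v t : List ℕ) :
    shuffleSum (fun w => shuffleSum F w t) u v = shuffleSum (fun w => shuffleSum F u w) v t := by
  induction h : u.length + v.length + t.length using Nat.strong_induction_on
    generalizing F u v t with
  | _ n ih =>
    subst h
    match u, v, t with
    | [], v, t => simp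
    | a :: u, [], t => simp
    | a :: u, b :: v, [] => simp
    | a :: u, b :: v, c :: t =>
      have h1 := ih _ (by simp) (fun w => F (a :: w)) u (b :: v) (c :: t) rfl
      have h2 := ih _ (by simp) (fun w => F (b :: w)) (a :: u) v (c :: t) rfl
      have h3 := ih _ (by simp) (fun w => F (c :: w)) (a :: u) (b :: v) t rfl
      simp only [shuffleSum_cons_cons, shuffleSum_add] at h1 h2 h3 ⊢
      rw [add_add_add_comm, h1, h2, h3]
      abel

/-- Shuffles are compatible with deconcatenation. -/
theorem shuffleSum_splitSum (F : List ℕ → List ℕ → M) (u v : List ℕ) :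
    shuffleSum (fun w => splitSum F w) u v =
      splitSum (fun u₁ u₂ => splitSum (fun v₁ v₂ =>
        shuffleSum (fun p => shuffleSum (F p) u₂ v₂) u₁ v₁) v) u := by
  induction u, v using shuffle_induction generalizing F with
  | nil_left v => simp
  | nil_right a u => simp
  | cons_cons a u b v ih1 ih2 =>
    have h1 := ih1 (fun p q => F (a :: p) q)
    have h2 := ih2 (fun p q => F (b :: p) q)
    simp only [shuffleSum_cons_cons, splitSum_cons, shuffleSum_add, splitSum_add,
      shuffleSum_nil_left, shuffleSum_nil_right] at h1 h2 ⊢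
    rw [h1, h2]
    abel

end Sums

/-! ### Shuffles -/

theorem IsShuffle.length {u v w : List ℕ} (h : IsShuffle u v w) :
    w.length = u.length + v.length := by
  induction h with
  | nil => rfl
  | left a _ ih => simp [ih]; omega
  | right a _ ih => simp [ih]; omega

theorem IsShuffle.mem_iff {u v w : List ℕ} (h : IsShuffle u v w) {a : ℕ} :
    a ∈ w ↔ a ∈ u ∨ a ∈ v := by
  induction h with
  | nil => simp
  | left a _ ih => simp [ih, or_assoc]
  | right a _ ih => simp [ih]; tauto

theorem IsShuffle.countLE {u v w : List ℕ} (h : IsShuffle u v w) (i : ℕ) :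
    countLE w i = countLE u i + countLE v i := by
  induction h with
  | nil => rfl
  | left a _ ih => simp only [countLE_cons, ih]; omega
  | right a _ ih => simp only [countLE_cons, ih]; omega

theorem IsShuffle.append (u v : List ℕ) : IsShuffle u v (u ++ v) := by
  induction u with
  | nil =>
    induction v with
    | nil => exact .nil
    | cons a v ih => exact .right a ih
  | cons a u ih => exact .left a ih

/-- The shuffle of two words without common letters is multiplicity-free. -/
theorem shuffleSum_ite_eq {M : Type*} [AddCommMonoid M] (c : M) {u v : List ℕ}
    (h : ∀ a ∈ u, ∀ b ∈ v, a ≠ b) (w : List ℕ) [Decidable (IsShuffle u v w)] :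
    shuffleSum (fun t => if t = w then c else 0) u v = if IsShuffle u v w then c else 0 := by
  classical
  have hl : ∀ v w, IsShuffle [] v w ↔ v = w := fun v w => by
    refine ⟨fun h => ?_, fun h => h ▸ IsShuffle.append [] v⟩
    induction v generalizing w with
    | nil => cases h; rfl
    | cons a v ih => cases h with | right _ h => rw [ih _ h]
  have hr : ∀ u w, IsShuffle u [] w ↔ u = w := fun u w => by
    refine ⟨fun h => ?_, fun h => ?_⟩
    · induction u generalizing w with
      | nil => cases h; rfl
      | cons a v ih => cases h with | left _ h => rw [ih _ h]
    · simpa [h] using IsShuffle.append u []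
  induction u, v using shuffle_induction generalizing w with
  | nil_left v => simp [hl]
  | nil_right a u => simp [hr]
  | cons_cons a u b v ih1 ih2 =>
    have hab : a ≠ b := h a (by simp) b (by simp)
    rw [shuffleSum_cons_cons]
    rcases w with _ | ⟨c', w⟩
    · have : ¬ IsShuffle (a :: u) (b :: v) [] := fun h => by cases h
      simp [shuffleSum_zero, this]
    have h1 := ih1 (fun x hx y hy => h x (by simp [hx]) y hy) w
    have h2 := ih2 (fun x hx y hy => h x hx y (by simp [hy])) w
    by_cases ha : a = c'
    · subst ha
      have : IsShuffle (a :: u) (b :: v) (a :: w) ↔ IsShuffle u (b :: v) w :=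
        ⟨fun h => by cases h with
          | left _ h => exact h
          | right _ h => exact absurd rfl hab, fun h => .left a h⟩
      simp [hab.symm, shuffleSum_zero, this, h1]
    · by_cases hb : b = c'
      · subst hb
        have : IsShuffle (a :: u) (b :: v) (b :: w) ↔ IsShuffle (a :: u) v w :=
          ⟨fun h => by cases h with
            | right _ h => exact h
            | left _ h => exact absurd rfl hab, fun h => .right b h⟩
        simp [hab, shuffleSum_zero, this, h2]
      · have : ¬ IsShuffle (a :: u) (b :: v) (c' :: w) := fun h => by
          cases h with
          | right _ h => exact hb rfl
          | left _ h => exact ha rfl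
        simp [ha, hb, shuffleSum_zero, this]

/-! ### Words as linear functionals -/

theorem parkList_parkList (l : List ℕ) : parkList (parkList l) = parkList l :=
  parkList_restrict_parkList id (fun _ => List.Sublist.refl _) (fun _ _ => rfl) l

/-- The segment of spots from `p + 1` to `q` is large enough for the cars preferring a spot in it:
none of them has to leave it when they are parked. -/
def Fits (l : List ℕ) (p q : ℕ) : Prop :=
  ∀ j, p ≤ j → j ≤ q → countLE l q + j ≤ countLE l j + q

theorem Fits.of_sublist {l l' : List ℕ} (h : l.Sublist l') {p q : ℕ} (hl : Fits l' p q) :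
    Fits l p q := fun j h1 h2 => by
  have := hl j h1 h2
  have := countLE_add_le_of_sublist h h2
  omega

theorem Fits.trans {l : List ℕ} {p q s : ℕ} (h : Fits l p q) (h' : Fits l q s) (hqs : q ≤ s) :
    Fits l p s := fun j h1 h2 => by
  rcases le_total j q with hj | hj
  · have := h j h1 hj
    have := h' q le_rfl hqs
    omega
  · exact h' j hj h2

theorem Fits.mono_left {l : List ℕ} {p p' q : ℕ} (h : Fits l p q) (hp : p ≤ p') : Fits l p' q :=
  fun j h1 h2 => h j (hp.trans h1) h2

theorem Fits.refl (l : List ℕ) (p : ℕ) : Fits l p p := fun j h1 h2 => by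
  obtain rfl : j = p := by omega
  omega

theorem IsParking.fits {l : List ℕ} (h : IsParking l) : Fits l 0 l.length := fun j _ h2 => by
  have := h.le_countLE h2
  have := countLE_le_length l l.length
  omega

theorem exists_forall_fits (l : List ℕ) :
    ∃ N₀, ∀ N, N₀ ≤ N → (∀ a ∈ l, a ≤ N) ∧ Fits l 0 N := by
  refine ⟨l.sum + l.length, fun N hN => ⟨fun a ha => ?_, fun j _ h2 => ?_⟩⟩
  · have := List.single_le_sum (fun _ _ => Nat.zero_le _) a ha
    omega
  · by_cases hj : ∀ a ∈ l, a ≤ j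
    · have := countLE_eq_length hj
      have := countLE_le_length l N
      omega
    · push Not at hj
      obtain ⟨a, ha, hlt⟩ := hj
      have := List.single_le_sum (fun _ _ => Nat.zero_le _) a ha
      have := countLE_le_length l N
      omega

/-- The relabelling of letters that parkizes all the words in the shuffle of `l₁` and of `l₂`
shifted by `N`. -/
def shuffleSlot (l₁ l₂ : List ℕ) (N v : ℕ) : ℕ :=
  if v ≤ N then slot l₁ v else l₁.length + slot l₂ (v - N)

theorem countLE_map_add (l : List ℕ) (N j : ℕ) :
    countLE (l.map (· + N)) (N + j) = countLE l j :=
  countLE_map _ _ _ _ fun a _ => by omega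

theorem countLE_map_add_eq_zero {l : List ℕ} (hl : ∀ a ∈ l, 1 ≤ a) {N j : ℕ} (hj : j ≤ N) :
    countLE (l.map (· + N)) j = 0 :=
  countLE_eq_zero fun a ha => by
    obtain ⟨b, hb, rfl⟩ := List.mem_map.1 ha
    have := hl b hb
    omega

/-- In a shuffle of `l₁` with `l₂` shifted by `N`, the letters from `l₁` are parkized as in `l₁`
alone, and those from `l₂` as in `l₂` alone with a shift by `|l₁|`, because the cars of `l₁` fill
`|l₁|` of the first `N` spots. -/
theorem slot_of_isShuffle {l₁ l₂ w : List ℕ} {N : ℕ} (h1 : ∀ a ∈ l₁, 1 ≤ a)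
    (h2 : ∀ a ∈ l₂, 1 ≤ a)
    (hN : ∀ a ∈ l₁, a ≤ N) (hF : Fits l₁ 0 N) (h : IsShuffle l₁ (l₂.map (· + N)) w) (v : ℕ) :
    slot w v = shuffleSlot l₁ l₂ N v := by
  have hlow : ∀ v ≤ N, slot w v = slot l₁ v := fun v hv => slot_congr fun j hj => by
    rw [h.countLE, countLE_map_add_eq_zero h2 (by omega), add_zero]
  have hlen : ∀ j, countLE w (N + j) = l₁.length + countLE l₂ j := fun j => by
    rw [h.countLE, countLE_map_add, countLE_eq_length fun a ha => (hN a ha).trans (by omega)]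
  have hhigh : ∀ v, slot w (N + v + 1) = l₁.length + slot l₂ (v + 1) := by
    intro v
    induction v with
    | zero =>
      have h0 : l₁.length ≤ slot l₁ N := by
        have hc := countLE_eq_length hN
        refine le_slot ?_ fun j hj => ?_
        · have := hF 0 le_rfl (by omega)
          have := countLE_eq_zero h1
          omega
        · have := hF j (by omega) hj.le
          omega
      have hc := countLE_eq_zero h2
      have := hlen 0
      rw [add_zero] at this ⊢
      rw [slot_succ, hlow _ le_rfl, this, slot_succ, slot_zero]
      omega
    | succ v ih =>
      rw [slot_succ, show N + (v + 1) = N + v + 1 by ring, ih, slot_succ l₂ (v + 1),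
        show N + v + 1 = N + (v + 1) by ring, hlen]
      omega
  unfold shuffleSlot
  split_ifs with hv
  · exact hlow v hv
  · obtain ⟨k, rfl⟩ : ∃ k, v = N + k + 1 := ⟨v - N - 1, by omega⟩
    rw [hhigh, show N + k + 1 - N = k + 1 by omega]

theorem parkList_of_isShuffle {l₁ l₂ w : List ℕ} {N : ℕ} (h1 : ∀ a ∈ l₁, 1 ≤ a)
    (h2 : ∀ a ∈ l₂, 1 ≤ a) (hN : ∀ a ∈ l₁, a ≤ N) (hF : Fits l₁ 0 N)
    (h : IsShuffle l₁ (l₂.map (· + N)) w) :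
    parkList w = w.map (shuffleSlot l₁ l₂ N) := by
  rw [parkList_eq_map_slot]
  exact List.map_congr_left fun a _ => slot_of_isShuffle h1 h2 hN hF h a

theorem map_shuffleSlot_left {l₁ l₂ : List ℕ} {N : ℕ} (hN : ∀ a ∈ l₁, a ≤ N) :
    l₁.map (shuffleSlot l₁ l₂ N) = parkList l₁ := by
  rw [parkList_eq_map_slot]
  exact List.map_congr_left fun a ha => if_pos (hN a ha)

theorem map_shuffleSlot_right {l₁ l₂ : List ℕ} {N : ℕ} (h2 : ∀ a ∈ l₂, 1 ≤ a) :
    (l₂.map (· + N)).map (shuffleSlot l₁ l₂ N) = (parkList l₂).map (· + l₁.length) := by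
  rw [parkList_eq_map_slot, List.map_map, List.map_map]
  refine List.map_congr_left fun a ha => ?_
  have := h2 a ha
  simp only [Function.comp, shuffleSlot]
  rw [if_neg (by omega), Nat.add_sub_cancel, add_comm]

/-- A word in the shifted shuffle of two parking functions is a parking function. -/
theorem isParking_of_isShiftedShuffle {u v w : List ℕ} (hu : IsParking u) (hv : IsParking v)
    (h : IsShiftedShuffle u v w) : IsParking w := by
  have hpos : ∀ a ∈ w, 1 ≤ a := fun a ha => by
    rcases (IsShuffle.mem_iff h).1 ha with ha | ha
    · exact hu.1 a ha
    · obtain ⟨b, hb, rfl⟩ := List.mem_map.1 ha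
      have := hv.1 b hb
      omega
  have h1 := isParking_parkList w hpos
  rwa [parkList_of_isShuffle hu.1 hv.1 (fun a => hu.le_length) hu.fits h,
    show w.map (shuffleSlot u v u.length) = w from ?_] at h1
  conv_rhs => rw [← List.map_id w]
  refine List.map_congr_left fun a ha => ?_
  simp only [shuffleSlot, id]
  split_ifs with hle
  · exact hu.slot_eq hle
  · rcases (IsShuffle.mem_iff h).1 ha with ha | ha
    · exact absurd (hu.le_length ha) hle
    · obtain ⟨b, hb, rfl⟩ := List.mem_map.1 ha
      rw [Nat.add_sub_cancel, hv.slot_eq (hv.le_length hb), add_comm]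

section Coeff

variable (K : Type*) [Field K]

open Classical in
/-- The linear functional reading off the coefficient of the word `l` in the realization of an
element of `PQSym*` as a sum of words. It vanishes if `l` has a letter `0`. -/
noncomputable def ev (l : List ℕ) : PQSymDual K →ₗ[K] K :=
  if h : IsParking (parkList l) then (G K).coord ⟨parkList l, h⟩ else 0

variable {K}

theorem wordCoeff_eq_ev (x : PQSymDual K) (w : Word) : wordCoeff x w = ev K w.1 x := by
  unfold ev
  rw [dif_pos (isParking_parkList w.1 w.2)]
  rfl

theorem ev_of_not_pos {l : List ℕ} (h : ¬ ∀ a ∈ l, 1 ≤ a) : ev K l = 0 :=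
  dif_neg fun hp => h (isParking_parkList_iff.1 hp)

theorem ev_congr {l l' : List ℕ} (h : parkList l = parkList l') : ev K l = ev K l' := by
  have key : ∀ m, parkList l' = m → ev K l' =
      open Classical in if h : IsParking m then (G K).coord ⟨m, h⟩ else 0 := by
    rintro _ rfl
    rfl
  rw [key _ h.symm]
  rfl

theorem ev_parkList (l : List ℕ) : ev K (parkList l) = ev K l := ev_congr (parkList_parkList l)

theorem ev_coe (u : ParkingFunction) : ev K u.1 = (G K).coord u := by
  unfold ev
  have h : parkList u.1 = u.1 := u.2.parkList_eq
  rw [dif_pos (by rw [h]; exact u.2)]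
  congr 1
  exact Subtype.ext h

theorem ev_basis (l : List ℕ) (u : ParkingFunction) :
    ev K l (G K u) = if parkList l = u.1 then 1 else 0 := by
  classical
  unfold ev
  split_ifs with h1 h2 h2
  · rw [Module.Basis.coord_apply, Module.Basis.repr_self, Finsupp.single_apply,
      if_pos (Subtype.ext h2.symm)]
  · rw [Module.Basis.coord_apply, Module.Basis.repr_self, Finsupp.single_apply,
      if_neg fun h => h2 (by rw [h])]
  · exact absurd (h2 ▸ u.2) h1
  · rfl

theorem ext_ev {x y : PQSymDual K} (h : ∀ l, IsParking l → ev K l x = ev K l y) : x = y := by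
  refine (G K).ext_elem fun u => ?_
  have := h u.1 u.2
  rwa [ev_coe] at this

theorem ev_one (l : List ℕ) : ev K l 1 = if l = [] then 1 else 0 := by
  have h := ev_basis (K := K) l emptyPF
  have : parkList l = [] ↔ l = [] := by
    rw [← List.length_eq_zero_iff, length_parkList, List.length_eq_zero_iff]
  simp only [emptyPF, this] at h
  exact h

theorem mem_parkingOfLength {n : ℕ} {u : ParkingFunction} :
    u ∈ parkingOfLength n ↔ u.1.length = n := by
  simp [parkingOfLength]

theorem ev_basis_mul_basis (l : List ℕ) (u v : ParkingFunction) :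
    ev K l (G K u * G K v) =
      if l.length = u.1.length + v.1.length ∧ parkList (l.take u.1.length) = u.1 ∧
        parkList (l.drop u.1.length) = v.1 then 1 else 0 := by
  classical
  have hmul : G K u * G K v = ∑ w ∈ (parkingOfLength (u.1.length + v.1.length)).filter
      (fun w => ∃ a b : Word, w.1 = a.1 ++ b.1 ∧ park a = u ∧ park b = v), G K w := by
    change mulMap K (G K u) (G K v) = _
    rw [mulMap, Module.Basis.constr_basis, Module.Basis.constr_basis]
  rw [hmul, map_sum]
  simp only [ev_basis]
  by_cases hl : ∀ a ∈ l, 1 ≤ a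
  · have h1 : ∀ w : ParkingFunction, parkList l = w.1 ↔
        (⟨parkList l, isParking_parkList l hl⟩ : ParkingFunction) = w := fun w =>
      ⟨fun h => Subtype.ext h, fun h => congrArg Subtype.val h⟩
    simp only [h1]
    rw [Finset.sum_ite_eq]
    congr 1
    rw [Finset.mem_filter, mem_parkingOfLength, length_parkList]
    refine propext ⟨?_, ?_⟩
    · rintro ⟨hlen, a, b, hab, rfl, rfl⟩
      have ha : (park a).1.length = a.1.length := length_parkList _
      refine ⟨hlen, ?_, ?_⟩
      · rw [← parkList_take_parkList, show parkList l = a.1 ++ b.1 from hab, ha, List.take_left]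
        rfl
      · rw [← parkList_drop_parkList, show parkList l = a.1 ++ b.1 from hab, ha, List.drop_left]
        rfl
    · rintro ⟨hlen, h1, h2⟩
      have hp := (isParking_parkList l hl).1
      refine ⟨hlen, ⟨(parkList l).take u.1.length, fun a ha => hp a (List.mem_of_mem_take ha)⟩,
        ⟨(parkList l).drop u.1.length, fun a ha => hp a (List.mem_of_mem_drop ha)⟩, ?_, ?_, ?_⟩
      · exact (List.take_append_drop _ _).symm
      · exact Subtype.ext ((parkList_take_parkList _ _).trans h1)
      · exact Subtype.ext ((parkList_drop_parkList _ _).trans h2)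
  · rw [if_neg, Finset.sum_eq_zero]
    · intro w _
      exact if_neg fun h => hl (isParking_parkList_iff.1 (by rw [h]; exact w.2))
    · rintro ⟨-, h1, h2⟩
      refine hl fun a ha => ?_
      rw [← List.take_append_drop u.1.length l, List.mem_append] at ha
      rcases ha with ha | ha
      · exact isParking_parkList_iff.1 (by rw [h1]; exact u.2) a ha
      · exact isParking_parkList_iff.1 (by rw [h2]; exact v.2) a ha

/-- In terms of words, the product of `PQSym*` is the concatenation product. -/
theorem ev_mul (l : List ℕ) (x y : PQSymDual K) :
    ev K l (x * y) = splitSum (fun p q => ev K p x * ev K q y) l := by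
  have key : (mulMap K).compr₂ (ev K l) =
      splitSum (fun p q => (LinearMap.mul K K).compl₁₂ (ev K p) (ev K q)) l := by
    refine (G K).ext fun u => (G K).ext fun v => ?_
    have h1 := ev_basis_mul_basis (K := K) l u v
    have h2 : (splitSum (fun p q => (LinearMap.mul K K).compl₁₂ (ev K p) (ev K q)) l) (G K u)
        (G K v) = ∑ k ∈ Finset.range (l.length + 1),
          ev K (l.take k) (G K u) * ev K (l.drop k) (G K v) := by
      rw [splitSum_eq_sum_range]
      simp
    rw [h2]
    refine h1.trans ?_
    simp only [ev_basis]
    by_cases hu : u.1.length ≤ l.length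
    · rw [Finset.sum_eq_single u.1.length]
      · by_cases h3 : parkList (l.take u.1.length) = u.1
        · by_cases h4 : parkList (l.drop u.1.length) = v.1
          · have := congrArg List.length h4
            rw [length_parkList, List.length_drop] at this
            rw [if_pos ⟨by omega, h3, h4⟩, if_pos h3, if_pos h4, mul_one]
          · rw [if_neg (by tauto), if_neg h4, mul_zero]
        · rw [if_neg (by tauto), if_neg h3, zero_mul]
      · intro k hk hne
        rw [Finset.mem_range] at hk
        rw [if_neg, zero_mul]
        intro h
        have := congrArg List.length h
        rw [length_parkList, List.length_take] at this
        omega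
      · intro h
        simp at h
        omega
    · rw [if_neg (by omega), Finset.sum_eq_zero]
      intro k hk
      rw [if_neg, zero_mul]
      intro h
      have := congrArg List.length h
      rw [length_parkList, List.length_take] at this
      omega
  have h := LinearMap.congr_fun (LinearMap.congr_fun key x) y
  rw [splitSum_eq_sum_range] at h ⊢
  simp only [LinearMap.sum_apply] at h
  exact h

variable (K) in
/-- The functional `ev a ⊗ ev b` on `PQSym* ⊗ PQSym*`. -/
noncomputable def ev₂ (a b : List ℕ) : PQSymDual K ⊗[K] PQSymDual K →ₗ[K] K :=
  LinearMap.mul' K K ∘ₗ TensorProduct.map (ev K a) (ev K b)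

@[simp] theorem ev₂_tmul (a b : List ℕ) (x y : PQSymDual K) :
    ev₂ K a b (x ⊗ₜ y) = ev K a x * ev K b y := by
  simp [ev₂]

theorem ext_ev₂ {s t : PQSymDual K ⊗[K] PQSymDual K}
    (h : ∀ a b, IsParking a → IsParking b → ev₂ K a b s = ev₂ K a b t) : s = t := by
  refine ((G K).tensorProduct (G K)).ext_elem fun ⟨a, b⟩ => ?_
  have key : ∀ t, ((G K).tensorProduct (G K)).repr t (a, b) = ev₂ K a.1 b.1 t := by
    intro t
    have : ((G K).tensorProduct (G K)).coord (a, b) = ev₂ K a.1 b.1 := by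
      refine TensorProduct.ext' fun x y => ?_
      simp [ev_coe, mul_comm]
    exact LinearMap.congr_fun this t
  rw [key, key]
  exact h a.1 b.1 a.2 b.2

open Classical in
theorem comul_basis (u : ParkingFunction) :
    CoalgebraStruct.comul (R := K) (G K u) =
      ∑ ij ∈ Finset.HasAntidiagonal.antidiagonal u.1.length,
        ∑ ab ∈ (parkingOfLength ij.1 ×ˢ parkingOfLength ij.2).filter
          (fun ab => IsShiftedShuffle ab.1.1 ab.2.1 u.1), G K ab.1 ⊗ₜ[K] G K ab.2 :=
  (G K).constr_basis K _ u

theorem ev₂_comul_basis (u : ParkingFunction) (a b : List ℕ) (ha : IsParking a) (hb : IsParking b)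
    [Decidable (IsShiftedShuffle a b u.1)] :
    ev₂ K a b (CoalgebraStruct.comul (R := K) (G K u)) =
      if IsShiftedShuffle a b u.1 then 1 else 0 := by
  classical
  rw [comul_basis]
  simp only [map_sum, ev₂_tmul, ev_basis, ha.parkList_eq, hb.parkList_eq]
  have h1 : ∀ w : ParkingFunction × ParkingFunction,
      ((if a = w.1.1 then (1 : K) else 0) * if b = w.2.1 then 1 else 0) =
        if ((⟨a, ha⟩, ⟨b, hb⟩) : ParkingFunction × ParkingFunction) = w then 1 else 0 := fun w => by
    rw [ite_zero_mul_ite_zero, mul_one]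
    congr 1
    rw [Prod.ext_iff, Subtype.ext_iff, Subtype.ext_iff]
  simp only [h1, Finset.sum_ite_eq, Finset.mem_filter, Finset.mem_product, mem_parkingOfLength]
  have h2 : ∀ ij : ℕ × ℕ, ((a.length = ij.1 ∧ b.length = ij.2) ∧ IsShiftedShuffle a b u.1) ↔
      ((a.length, b.length) = ij ∧ IsShiftedShuffle a b u.1) := fun ij => by
    rw [Prod.ext_iff]
  simp only [h2, ite_and, Finset.sum_ite_eq]
  split_ifs with h3 h4 h4
  · rfl
  · rfl
  · have := IsShuffle.length h4
    rw [List.length_map] at this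
    simp at h3
    omega
  · rfl

theorem ev₂_comul_of_isParking {a b : List ℕ} (ha : IsParking a) (hb : IsParking b)
    (x : PQSymDual K) :
    ev₂ K a b (CoalgebraStruct.comul (R := K) x) =
      shuffleSum (fun w => ev K w x) a (b.map (· + a.length)) := by
  classical
  have key : ev₂ K a b ∘ₗ CoalgebraStruct.comul (R := K) =
      shuffleSum (fun w => ev K w) a (b.map (· + a.length)) := by
    refine (G K).ext fun u => ?_
    rw [LinearMap.comp_apply, ev₂_comul_basis u a b ha hb]
    refine Eq.trans ?_ (map_shuffleSum (LinearMap.applyₗ (R := K) (G K u)) (fun w => ev K w)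
      a (b.map (· + a.length))).symm
    rw [IsShiftedShuffle, ← shuffleSum_ite_eq]
    · refine shuffleSum_congr fun w hw => ?_
      rw [LinearMap.applyₗ_apply_apply, ev_basis,
        (isParking_of_isShiftedShuffle ha hb hw).parkList_eq]
    · intro c hc d hd
      obtain ⟨e, he, rfl⟩ := List.mem_map.1 hd
      have := ha.le_length hc
      have := hb.1 e he
      omega
  refine (LinearMap.congr_fun key x).trans ?_
  exact map_shuffleSum (LinearMap.applyₗ (R := K) x) (fun w => ev K w) a _

/-- In terms of words, the coproduct of `PQSym*` is given by the ordered sum of two alphabets: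
`N` is large enough for the cars `a` to be parked in the spots up to `N`, and `b` is shifted to the
right of `N`. -/
theorem ev₂_comul {a b : List ℕ} {N : ℕ} (ha : ∀ c ∈ a, 1 ≤ c) (hb : ∀ c ∈ b, 1 ≤ c)
    (hN : ∀ c ∈ a, c ≤ N) (hF : Fits a 0 N) (x : PQSymDual K) :
    ev₂ K a b (CoalgebraStruct.comul (R := K) x) =
      shuffleSum (fun w => ev K w x) a (b.map (· + N)) := by
  have h := ev₂_comul_of_isParking (isParking_parkList a ha) (isParking_parkList b hb) x
  have h' : ev₂ K (parkList a) (parkList b) = ev₂ K a b := by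
    unfold ev₂
    rw [ev_parkList, ev_parkList]
  rw [h', length_parkList, ← map_shuffleSlot_left (l₂ := b) hN, ← map_shuffleSlot_right hb,
    shuffleSum_map] at h
  rw [h]
  refine shuffleSum_congr fun w hw => ?_
  rw [← parkList_of_isShuffle ha hb hN hF hw, ev_parkList]

theorem counit_eq_ev : CoalgebraStruct.counit (R := K) (A := PQSymDual K) = ev K [] :=
  (ev_coe emptyPF).symm

theorem ev₂_comm (a b : List ℕ) (t : PQSymDual K ⊗[K] PQSymDual K) :
    ev₂ K a b (TensorProduct.comm K _ _ t) = ev₂ K b a t := by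
  have : ev₂ K a b ∘ₗ (TensorProduct.comm K _ _).toLinearMap = ev₂ K b a :=
    TensorProduct.ext' fun x y => by simp [mul_comm]
  exact LinearMap.congr_fun this t

end Coeff

/-! ### The bialgebra structure -/

section Bialgebra

variable {K : Type*} [Field K]

variable (K) in
/-- The ring structure of `PQSym*`. -/
@[reducible] noncomputable def ringPQSym : Ring (PQSymDual K) where
  __ := (inferInstance : AddCommGroup (PQSymDual K))
  mul := (· * ·)
  one := 1
  left_distrib x y z := map_add (mulMap K x) y z
  right_distrib x y z := LinearMap.congr_fun (map_add (mulMap K) x y) z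
  zero_mul x := LinearMap.congr_fun (map_zero (mulMap K)) x
  mul_zero x := map_zero (mulMap K x)
  mul_assoc x y z := ext_ev fun l _ => by
    have h := splitSum_splitSum (fun p q t => ev K p x * ev K q y * ev K t z) l
    rw [ev_mul, ev_mul]
    simp only [ev_mul]
    refine Eq.trans ?_ (h.trans ?_)
    · exact splitSum_congr fun k => map_splitSum (AddMonoidHom.mulRight _) _ _
    · refine splitSum_congr fun k => ?_
      simp only [mul_assoc]
      exact (map_splitSum (AddMonoidHom.mulLeft (ev K (l.take k) x)) _ _).symm
  one_mul x := ext_ev fun l _ => by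
    rw [ev_mul]
    cases l with
    | nil => simp [ev_one]
    | cons a l => simp [splitSum_cons, ev_one, splitSum_zero]
  mul_one x := ext_ev fun l _ => by
    rw [ev_mul]
    simp only [ev_one, mul_ite, mul_one, mul_zero]
    rw [splitSum_eq_sum_range, Finset.sum_range_succ, Finset.sum_eq_zero]
    · simp
    · intro k hk
      rw [if_neg]
      simpa using hk

attribute [scoped instance] ringPQSym

variable (K) in
/-- The algebra structure of `PQSym*`. -/
@[reducible] noncomputable def algebraPQSym : Algebra K (PQSymDual K) :=
  Algebra.ofModule
    (fun c x y => LinearMap.congr_fun (map_smul (mulMap K) c x) y)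
    (fun c x y => map_smul (mulMap K x) c y)

attribute [scoped instance] algebraPQSym

theorem ev₂_mul (a b : List ℕ) (s t : PQSymDual K ⊗[K] PQSymDual K) :
    ev₂ K a b (s * t) = splitSum (fun a₁ a₂ => splitSum (fun b₁ b₂ =>
      ev₂ K a₁ b₁ s * ev₂ K a₂ b₂ t) b) a := by
  induction s using TensorProduct.induction_on with
  | zero => simp [splitSum_zero]
  | add s s' h h' => simp only [add_mul, map_add, h, h', splitSum_add]
  | tmul x y =>
    induction t using TensorProduct.induction_on with
    | zero => simp [splitSum_zero]
    | add s s' h h' => simp only [mul_add, map_add, h, h', splitSum_add]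
    | tmul x' y' =>
      rw [Algebra.TensorProduct.tmul_mul_tmul, ev₂_tmul, ev_mul, ev_mul]
      simp only [ev₂_tmul]
      refine (map_splitSum (AddMonoidHom.mulRight _) _ _).trans (splitSum_congr fun k => ?_)
      refine (map_splitSum (AddMonoidHom.mulLeft _) _ _).trans (splitSum_congr fun j => ?_)
      exact mul_mul_mul_comm _ _ _ _

/-- The coproduct is multiplicative because shuffles are compatible with deconcatenation and because
the subwords of a parking function of length `n` can still be parked in `n` spots. -/
theorem comul_mul (x y : PQSymDual K) :
    CoalgebraStruct.comul (R := K) (x * y) =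
      CoalgebraStruct.comul (R := K) x * CoalgebraStruct.comul (R := K) y := by
  refine ext_ev₂ fun a b ha hb => ?_
  rw [ev₂_comul ha.1 hb.1 (fun c => ha.le_length) ha.fits, ev₂_mul]
  simp only [ev_mul]
  rw [shuffleSum_splitSum]
  refine splitSum_congr fun k => ?_
  rw [splitSum_map]
  refine splitSum_congr fun j => ?_
  have ht : ∀ c ∈ a.take k, c ∈ a := fun c => List.mem_of_mem_take
  have hd : ∀ c ∈ a.drop k, c ∈ a := fun c => List.mem_of_mem_drop
  have ht' : ∀ c ∈ b.take j, c ∈ b := fun c => List.mem_of_mem_take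
  have hd' : ∀ c ∈ b.drop j, c ∈ b := fun c => List.mem_of_mem_drop
  rw [ev₂_comul (fun c hc => ha.1 c (ht c hc)) (fun c hc => hb.1 c (ht' c hc))
      (fun c hc => ha.le_length (ht c hc)) (ha.fits.of_sublist (List.take_sublist _ _)),
    ev₂_comul (fun c hc => ha.1 c (hd c hc)) (fun c hc => hb.1 c (hd' c hc))
      (fun c hc => ha.le_length (hd c hc)) (ha.fits.of_sublist (List.drop_sublist _ _))]
  refine Eq.trans ?_ (map_shuffleSum (AddMonoidHom.mulRight _) _ _ _).symm
  refine shuffleSum_congr fun w _ => ?_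
  exact (map_shuffleSum (AddMonoidHom.mulLeft (ev K w x)) _ _ _).symm

theorem shuffleSum_ev_one (a b : List ℕ) :
    shuffleSum (fun w => ev K w 1) a b = ev K a 1 * ev K b 1 := by
  simp only [ev_one]
  cases a with
  | nil => simp
  | cons c a =>
    cases b with
    | nil => simp
    | cons d b => simp [shuffleSum_cons_cons, shuffleSum_zero]

theorem comul_one : CoalgebraStruct.comul (R := K) (1 : PQSymDual K) = 1 := by
  refine ext_ev₂ fun a b ha hb => ?_
  rw [ev₂_comul ha.1 hb.1 (fun c => ha.le_length) ha.fits, shuffleSum_ev_one,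
    Algebra.TensorProduct.one_def, ev₂_tmul]
  congr 1
  cases b <;> simp [ev_one]

theorem counit_mul (x y : PQSymDual K) :
    CoalgebraStruct.counit (R := K) (x * y) =
      CoalgebraStruct.counit (R := K) x * CoalgebraStruct.counit (R := K) y := by
  rw [counit_eq_ev, ev_mul, splitSum_nil]

theorem counit_one : CoalgebraStruct.counit (R := K) (1 : PQSymDual K) = 1 := by
  rw [counit_eq_ev, ev_one, if_pos rfl]

/-- The functionals `ev a ⊗ ev b ⊗ ev c` separate the elements of the threefold tensor product. -/
theorem ext_ev₃ {s t : PQSymDual K ⊗[K] (PQSymDual K ⊗[K] PQSymDual K)}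
    (h : ∀ a b c, IsParking a → IsParking b → IsParking c →
      (LinearMap.mul' K K ∘ₗ TensorProduct.map (ev K a) (ev₂ K b c)) s =
        (LinearMap.mul' K K ∘ₗ TensorProduct.map (ev K a) (ev₂ K b c)) t) : s = t := by
  refine ((G K).tensorProduct ((G K).tensorProduct (G K))).ext_elem fun ⟨a, b, c⟩ => ?_
  have key : ∀ t, ((G K).tensorProduct ((G K).tensorProduct (G K))).repr t (a, b, c) =
      (LinearMap.mul' K K ∘ₗ TensorProduct.map (ev K a.1) (ev₂ K b.1 c.1)) t := by
    intro t
    have : ((G K).tensorProduct ((G K).tensorProduct (G K))).coord (a, b, c) =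
        LinearMap.mul' K K ∘ₗ TensorProduct.map (ev K a.1) (ev₂ K b.1 c.1) := by
      refine TensorProduct.ext' fun x y => ?_
      induction y using TensorProduct.induction_on with
      | zero => simp
      | add y y' h h' => rw [TensorProduct.tmul_add, map_add, map_add, h, h']
      | tmul y z => simp [ev_coe]; ring
    exact LinearMap.congr_fun this t
  rw [key, key]
  exact h a.1 b.1 c.1 a.2 b.2 c.2

theorem ev₂_comp_comul {a b : List ℕ} {N : ℕ} (ha : ∀ c ∈ a, 1 ≤ c) (hb : ∀ c ∈ b, 1 ≤ c)
    (hN : ∀ c ∈ a, c ≤ N) (hF : Fits a 0 N) :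
    ev₂ K a b ∘ₗ CoalgebraStruct.comul (R := K) = shuffleSum (fun w => ev K w) a (b.map (· + N)) :=
  LinearMap.ext fun x => (ev₂_comul ha hb hN hF x).trans
    (map_shuffleSum (LinearMap.applyₗ (R := K) x) (fun w => ev K w) a _).symm

/-- The coproduct is coassociative because shuffling words is associative. -/
theorem coassoc : TensorProduct.assoc K (PQSymDual K) (PQSymDual K) (PQSymDual K) ∘ₗ
    (CoalgebraStruct.comul (R := K)).rTensor (PQSymDual K) ∘ₗ CoalgebraStruct.comul (R := K) =
      (CoalgebraStruct.comul (R := K)).lTensor (PQSymDual K) ∘ₗ CoalgebraStruct.comul (R := K) := by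
  refine LinearMap.ext fun x => ext_ev₃ fun a b c ha hb hc => ?_
  have hl : (LinearMap.mul' K K ∘ₗ TensorProduct.map (ev K a) (ev₂ K b c)) ∘ₗ
      (TensorProduct.assoc K (PQSymDual K) (PQSymDual K) (PQSymDual K)).toLinearMap ∘ₗ
        (CoalgebraStruct.comul (R := K)).rTensor (PQSymDual K) =
      shuffleSum (fun w => ev₂ K w c) a (b.map (· + a.length)) := by
    refine TensorProduct.ext' fun y z => ?_
    have h := LinearMap.congr_fun
      (ev₂_comp_comul (K := K) ha.1 hb.1 (fun c => ha.le_length) ha.fits) y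
    have h1 : ∀ s : PQSymDual K ⊗[K] PQSymDual K,
        (LinearMap.mul' K K ∘ₗ TensorProduct.map (ev K a) (ev₂ K b c))
          (TensorProduct.assoc K _ _ _ (s ⊗ₜ z)) = ev₂ K a b s * ev K c z := by
      intro s
      induction s using TensorProduct.induction_on with
      | zero => simp
      | add s s' h h' => simp only [TensorProduct.add_tmul, map_add, h, h', add_mul]
      | tmul s s' => simp [mul_assoc]
    refine (h1 _).trans ?_
    refine Eq.trans ?_ (map_shuffleSum (LinearMap.applyₗ (R := K) (y ⊗ₜ[K] z))
      (fun w => ev₂ K w c) _ _).symm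
    simp only [LinearMap.applyₗ_apply_apply, ev₂_tmul]
    rw [ev₂_comul ha.1 hb.1 (fun c => ha.le_length) ha.fits]
    exact map_shuffleSum (AddMonoidHom.mulRight (ev K c z)) _ _ _
  have hr : (LinearMap.mul' K K ∘ₗ TensorProduct.map (ev K a) (ev₂ K b c)) ∘ₗ
        (CoalgebraStruct.comul (R := K)).lTensor (PQSymDual K) =
      shuffleSum (fun w => ev₂ K a w) b (c.map (· + b.length)) := by
    refine TensorProduct.ext' fun y z => ?_
    refine Eq.trans ?_ (map_shuffleSum (LinearMap.applyₗ (R := K) (y ⊗ₜ[K] z))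
      (fun w => ev₂ K a w) _ _).symm
    simp only [LinearMap.applyₗ_apply_apply, ev₂_tmul, LinearMap.comp_apply,
      LinearMap.lTensor_tmul, TensorProduct.map_tmul, LinearMap.mul'_apply]
    rw [ev₂_comul hb.1 hc.1 (fun c => hb.le_length) hb.fits]
    exact map_shuffleSum (AddMonoidHom.mulLeft (ev K a y)) _ _ _
  have hl' := LinearMap.congr_fun hl (CoalgebraStruct.comul (R := K) x)
  have hr' := LinearMap.congr_fun hr (CoalgebraStruct.comul (R := K) x)
  refine hl'.trans (Eq.trans ?_ hr'.symm)
  refine (map_shuffleSum (LinearMap.applyₗ (R := K) (CoalgebraStruct.comul (R := K) x))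
      (fun w => ev₂ K w c) _ _).trans (Eq.trans ?_
      (map_shuffleSum (LinearMap.applyₗ (R := K) (CoalgebraStruct.comul (R := K) x))
      (fun w => ev₂ K a w) _ _).symm)
  simp only [LinearMap.applyₗ_apply_apply]
  -- Both sides are sums over the shuffles of `a`, `b[|a|]` and `c[|a| + |b|]`.
  have h1 : shuffleSum (fun w => ev₂ K w c (CoalgebraStruct.comul (R := K) x)) a
      (b.map (· + a.length)) = shuffleSum (fun w => shuffleSum (fun w => ev K w x) w
        (c.map (· + (a.length + b.length)))) a (b.map (· + a.length)) := by
    refine shuffleSum_congr fun w hw => ?_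
    have hp := isParking_of_isShiftedShuffle ha hb hw
    have hlen := hw.length
    rw [List.length_map] at hlen
    rw [ev₂_comul hp.1 hc.1 (fun c => hp.le_length) hp.fits, hlen]
  have h2 : shuffleSum (fun w => ev₂ K a w (CoalgebraStruct.comul (R := K) x)) b
      (c.map (· + b.length)) = shuffleSum (fun w => shuffleSum (fun w => ev K w x) a
        (w.map (· + a.length))) b (c.map (· + b.length)) := by
    refine shuffleSum_congr fun w hw => ?_
    have hp := isParking_of_isShiftedShuffle hb hc hw
    rw [ev₂_comul ha.1 hp.1 (fun c => ha.le_length) ha.fits]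
  rw [h1, h2, shuffleSum_assoc, ← shuffleSum_map (fun w => shuffleSum (fun w => ev K w x) a w)
    (· + a.length), List.map_map]
  congr 2
  funext v
  simp only [Function.comp]
  ring

theorem counit_rTensor_comul : (CoalgebraStruct.counit (R := K)).rTensor (PQSymDual K) ∘ₗ
    CoalgebraStruct.comul (R := K) = TensorProduct.mk K K (PQSymDual K) 1 := by
  refine LinearMap.ext fun x => (TensorProduct.lid K (PQSymDual K)).injective <|
    ext_ev fun l hl => ?_
  have h : ∀ t, ev K l (TensorProduct.lid K (PQSymDual K)
      ((CoalgebraStruct.counit (R := K)).rTensor (PQSymDual K) t)) = ev₂ K [] l t := by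
    intro t
    induction t using TensorProduct.induction_on with
    | zero => simp
    | add s s' h h' => simp only [map_add, h, h']
    | tmul s s' => simp [counit_eq_ev]
  rw [LinearMap.comp_apply, h, ev₂_comul (N := 0) (by simp) hl.1 (by simp) (Fits.refl _ _)]
  simp

theorem counit_lTensor_comul : (CoalgebraStruct.counit (R := K)).lTensor (PQSymDual K) ∘ₗ
    CoalgebraStruct.comul (R := K) = (TensorProduct.mk K (PQSymDual K) K).flip 1 := by
  refine LinearMap.ext fun x => (TensorProduct.rid K (PQSymDual K)).injective <|
    ext_ev fun l hl => ?_
  have h : ∀ t, ev K l (TensorProduct.rid K (PQSymDual K)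
      ((CoalgebraStruct.counit (R := K)).lTensor (PQSymDual K) t)) = ev₂ K l [] t := by
    intro t
    induction t using TensorProduct.induction_on with
    | zero => simp
    | add s s' h h' => simp only [map_add, h, h']
    | tmul s s' => simp [counit_eq_ev, mul_comm]
  rw [LinearMap.comp_apply, h, ev₂_comul hl.1 (by simp) (fun c => hl.le_length) hl.fits]
  simp

variable (K) in
/-- The coalgebra structure of `PQSym*`. -/
@[reducible] noncomputable def coalgebraPQSym : Coalgebra K (PQSymDual K) where
  coassoc := coassoc
  rTensor_counit_comp_comul := counit_rTensor_comul
  lTensor_counit_comp_comul := counit_lTensor_comul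

attribute [scoped instance] coalgebraPQSym

variable (K) in
/-- The bialgebra structure of `PQSym*`. -/
@[reducible] noncomputable def bialgebraPQSym : Bialgebra K (PQSymDual K) :=
  Bialgebra.mk' K (PQSymDual K) counit_one (counit_mul _ _) comul_one (comul_mul _ _)

attribute [scoped instance] bialgebraPQSym

end Bialgebra

/-! ### The grading -/

section Grading

variable {K : Type*} [Field K]

theorem mem_homogeneous_iff {n : ℕ} {x : PQSymDual K} :
    x ∈ homogeneous K n ↔ ∀ l : List ℕ, l.length ≠ n → ev K l x = 0 := by
  rw [homogeneous, Module.Basis.mem_span_image]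
  constructor
  · intro h l hl
    by_cases hp : ∀ a ∈ l, 1 ≤ a
    · have := @h ⟨parkList l, isParking_parkList l hp⟩
      rw [← ev_parkList, show parkList l = (⟨parkList l, isParking_parkList l hp⟩ :
        ParkingFunction).1 from rfl, ev_coe, Module.Basis.coord_apply]
      by_contra h0
      have := this (by simpa using h0)
      exact hl (by simpa using this)
    · rw [ev_of_not_pos hp]; rfl
  · intro h u hu
    by_contra hn
    have := h u.1 hn
    rw [ev_coe, Module.Basis.coord_apply] at this
    simp [this] at hu

theorem basis_mem_homogeneous (u : ParkingFunction) : G K u ∈ homogeneous K u.1.length :=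
  Submodule.subset_span ⟨u, rfl, rfl⟩

theorem one_mem_homogeneous : (1 : PQSymDual K) ∈ homogeneous K 0 := basis_mem_homogeneous emptyPF

theorem mul_mem_homogeneous {i j : ℕ} {x y : PQSymDual K} (hx : x ∈ homogeneous K i)
    (hy : y ∈ homogeneous K j) : x * y ∈ homogeneous K (i + j) := by
  rw [mem_homogeneous_iff] at hx hy ⊢
  intro l hl
  rw [ev_mul, splitSum_eq_sum_range]
  refine Finset.sum_eq_zero fun k hk => ?_
  rw [Finset.mem_range] at hk
  by_cases h : (l.take k).length = i
  · rw [hy (l.drop k), mul_zero]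
    rw [List.length_take] at h
    rw [List.length_drop]
    omega
  · rw [hx _ h, zero_mul]

theorem comul_mem_homogeneous {n : ℕ} {x : PQSymDual K} (hx : x ∈ homogeneous K n) :
    CoalgebraStruct.comul (R := K) x ∈ ⨆ ij ∈ Finset.HasAntidiagonal.antidiagonal n,
      LinearMap.range (TensorProduct.mapIncl (homogeneous K ij.1) (homogeneous K ij.2)) := by
  classical
  revert x
  suffices h : homogeneous K n ≤ Submodule.comap (CoalgebraStruct.comul (R := K))
      (⨆ ij ∈ Finset.HasAntidiagonal.antidiagonal n,
      LinearMap.range (TensorProduct.mapIncl (homogeneous K ij.1) (homogeneous K ij.2))) from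
    fun x hx => h hx
  refine Submodule.span_le.2 ?_
  rintro _ ⟨u, hu, rfl⟩
  obtain rfl : u.1.length = n := hu
  rw [SetLike.mem_coe, Submodule.mem_comap, comul_basis]
  refine Submodule.sum_mem _ fun ij hij => Submodule.sum_mem _ fun ab hab => ?_
  refine Submodule.mem_iSup_of_mem ij (Submodule.mem_iSup_of_mem hij ?_)
  rw [Finset.mem_filter, Finset.mem_product, mem_parkingOfLength, mem_parkingOfLength] at hab
  obtain ⟨⟨h1, h2⟩, -⟩ := hab
  exact ⟨⟨G K ab.1, h1 ▸ basis_mem_homogeneous ab.1⟩ ⊗ₜ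
    ⟨G K ab.2, h2 ▸ basis_mem_homogeneous ab.2⟩, by simp [TensorProduct.mapIncl]⟩

variable (K) in
/-- The projection onto the homogeneous component of degree `n`. -/
noncomputable def homogeneousProj (n : ℕ) : PQSymDual K →ₗ[K] PQSymDual K :=
  (G K).constr K fun u => if u.1.length = n then G K u else 0

theorem ev_homogeneousProj (n : ℕ) (l : List ℕ) (x : PQSymDual K) :
    ev K l (homogeneousProj K n x) = if l.length = n then ev K l x else 0 := by
  have : ev K l ∘ₗ homogeneousProj K n = if l.length = n then ev K l else 0 := by
    refine (G K).ext fun u => ?_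
    rw [LinearMap.comp_apply, homogeneousProj, Module.Basis.constr_basis]
    by_cases h : parkList l = u.1
    · have hlen : l.length = u.1.length := by rw [← h, length_parkList]
      rw [hlen]
      split_ifs <;> simp
    · have h0 : ev K l (G K u) = 0 := by rw [ev_basis, if_neg h]
      split_ifs <;> simp [h0]
  have h := LinearMap.congr_fun this x
  rw [LinearMap.comp_apply] at h
  rw [h]
  split_ifs <;> rfl

theorem homogeneousProj_mem (n : ℕ) (x : PQSymDual K) : homogeneousProj K n x ∈ homogeneous K n :=
  mem_homogeneous_iff.2 fun l hl => by rw [ev_homogeneousProj, if_neg hl]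

theorem exists_sum_homogeneousProj (x : PQSymDual K) :
    ∃ N, x = ∑ n ∈ Finset.range N, homogeneousProj K n x := by
  refine ⟨((G K).repr x).support.sup (fun u => u.1.length) + 1, ext_ev fun l hl => ?_⟩
  rw [map_sum]
  simp only [ev_homogeneousProj, Finset.sum_ite_eq, Finset.mem_range]
  split_ifs with h
  · rfl
  · by_contra h0
    have h1 : ev K l x = (G K).repr x ⟨l, hl⟩ := by
      rw [← Module.Basis.coord_apply, ← ev_coe]
    have h2 : (⟨l, hl⟩ : ParkingFunction) ∈ ((G K).repr x).support := by
      rw [Finsupp.mem_support_iff, ← h1]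
      exact h0
    have := Finset.le_sup (f := fun u : ParkingFunction => u.1.length) h2
    simp only at this
    omega

theorem isInternal_homogeneous : DirectSum.IsInternal (homogeneous K) := by
  refine DirectSum.isInternal_submodule_of_iSupIndep_of_iSup_eq_top ?_ ?_
  · intro i
    rw [Submodule.disjoint_def]
    intro x hx hx'
    have h : ⨆ j, ⨆ (_ : j ≠ i), homogeneous K j ≤
        ⨅ l : {l : List ℕ // l.length = i}, LinearMap.ker (ev K l.1) := by
      refine iSup₂_le fun j hj => le_iInf fun l y hy => ?_
      exact mem_homogeneous_iff.1 hy l.1 (by rw [l.2]; exact hj.symm)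
    refine ext_ev fun l _ => ?_
    rw [map_zero]
    by_cases hl : l.length = i
    · exact (Submodule.mem_iInf _).1 (h hx') ⟨l, hl⟩
    · exact mem_homogeneous_iff.1 hx l hl
  · rw [eq_top_iff]
    rintro x -
    obtain ⟨N, hN⟩ := exists_sum_homogeneousProj x
    rw [hN]
    exact Submodule.sum_mem _ fun n _ => Submodule.mem_iSup_of_mem n (homogeneousProj_mem n x)

theorem counit_homogeneous {n : ℕ} (hn : n ≠ 0) {x : PQSymDual K} (hx : x ∈ homogeneous K n) :
    CoalgebraStruct.counit (R := K) x = 0 := by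
  rw [counit_eq_ev]
  exact mem_homogeneous_iff.1 hx [] (by simpa using hn.symm)

end Grading

/-! ### The antipode -/

section Antipode

open WithConv

variable {K : Type*} [Field K]

variable (K) in
/-- The difference `1 - id` in the convolution algebra, where `1` is the unit composed with the
counit. It vanishes in degree `0`. -/
noncomputable def oneSubId : WithConv (PQSymDual K →ₗ[K] PQSymDual K) := 1 - toConv LinearMap.id

variable (K) in
/-- The antipode, that is the convolution inverse of `id = 1 - (1 - id)`, given by the geometric
series in `1 - id`. In degree `n` this series stops at its `n`-th power. -/
noncomputable def antipodeMap : PQSymDual K →ₗ[K] PQSymDual K :=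
  (G K).constr K fun u => ∑ k ∈ Finset.range (u.1.length + 1), (oneSubId K ^ k).ofConv (G K u)

/-- On `G_u` the convolution product `f * g` only depends on the values of `f` and `g` at the `G_a` and
`G_b` with `|a| + |b| = |u|`. -/
theorem convMul_basis_congr {f g f' g' : WithConv (PQSymDual K →ₗ[K] PQSymDual K)}
    {u : ParkingFunction}
    (h : ∀ a b : ParkingFunction, a.1.length + b.1.length = u.1.length →
      f.ofConv (G K a) * g.ofConv (G K b) = f'.ofConv (G K a) * g'.ofConv (G K b)) :
    (f * g).ofConv (G K u) = (f' * g').ofConv (G K u) := by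
  classical
  have key : ∀ f g : WithConv (PQSymDual K →ₗ[K] PQSymDual K), (f * g).ofConv (G K u) =
      LinearMap.mul' K (PQSymDual K) (TensorProduct.map f.ofConv g.ofConv
        (CoalgebraStruct.comul (R := K) (G K u))) := fun _ _ => rfl
  rw [key, key, comul_basis]
  simp only [map_sum, TensorProduct.map_tmul, LinearMap.mul'_apply]
  refine Finset.sum_congr rfl fun ij hij => Finset.sum_congr rfl fun ab hab => h _ _ ?_
  rw [Finset.mem_filter, Finset.mem_product, mem_parkingOfLength, mem_parkingOfLength] at hab
  rw [Finset.HasAntidiagonal.mem_antidiagonal] at hij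
  omega

theorem oneSubId_pow_basis (k : ℕ) (u : ParkingFunction) (hu : u.1.length < k) :
    (oneSubId K ^ k).ofConv (G K u) = 0 := by
  induction k generalizing u with
  | zero => omega
  | succ k ih =>
    rw [pow_succ]
    refine (convMul_basis_congr (f' := 0) (g' := 0) fun a b hab => ?_).trans
      (by rw [zero_mul]; rfl)
    by_cases ha : a.1.length < k
    · rw [ih a ha]
      simp
    · have hb : b = emptyPF := Subtype.ext (List.length_eq_zero_iff.1 (by omega))
      have : (oneSubId K).ofConv (G K b) = 0 := by
        subst hb
        change (algebraMap K (PQSymDual K)) (Coalgebra.counit (R := K) (1 : PQSymDual K)) - 1 = 0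
        rw [show Coalgebra.counit (R := K) (1 : PQSymDual K) = 1 from counit_one, map_one, sub_self]
      rw [this]
      simp

theorem antipodeMap_basis {N : ℕ} {u : ParkingFunction} (h : u.1.length ≤ N) :
    antipodeMap K (G K u) = (∑ k ∈ Finset.range (N + 1), oneSubId K ^ k).ofConv (G K u) := by
  have h1 : (∑ k ∈ Finset.range (N + 1), oneSubId K ^ k).ofConv (G K u) =
      ∑ k ∈ Finset.range (N + 1), (oneSubId K ^ k).ofConv (G K u) := by
    induction Finset.range (N + 1) using Finset.induction_on with
    | empty => rfl
    | insert a s ha ih =>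
      rw [Finset.sum_insert ha, Finset.sum_insert ha, ← ih]
      rfl
  rw [h1, antipodeMap, Module.Basis.constr_basis]
  refine Finset.sum_subset (Finset.range_subset_range.2 (by omega)) fun k _ hk => ?_
  rw [Finset.mem_range] at hk
  exact oneSubId_pow_basis k u (by omega)

theorem antipodeMap_mul_id :
    toConv (antipodeMap K) * toConv (LinearMap.id : PQSymDual K →ₗ[K] PQSymDual K) = 1 := by
  refine ofConv_injective ((G K).ext fun u => ?_)
  have h1 : (toConv (antipodeMap K) * toConv LinearMap.id).ofConv (G K u) =
      ((∑ k ∈ Finset.range (u.1.length + 1), oneSubId K ^ k) * (1 - oneSubId K)).ofConv (G K u) := by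
    refine convMul_basis_congr fun a b hab => ?_
    rw [show (toConv (antipodeMap K)).ofConv (G K a) = antipodeMap K (G K a) from rfl,
      antipodeMap_basis (show a.1.length ≤ u.1.length by omega), oneSubId, sub_sub_cancel]
  rw [h1, geom_sum_mul_neg]
  change (1 : WithConv (PQSymDual K →ₗ[K] PQSymDual K)).ofConv (G K u) -
    (oneSubId K ^ (u.1.length + 1)).ofConv (G K u) = _
  rw [oneSubId_pow_basis _ u (by omega), sub_zero]

theorem id_mul_antipodeMap :
    toConv (LinearMap.id : PQSymDual K →ₗ[K] PQSymDual K) * toConv (antipodeMap K) = 1 := by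
  refine ofConv_injective ((G K).ext fun u => ?_)
  have h1 : (toConv LinearMap.id * toConv (antipodeMap K)).ofConv (G K u) =
      ((1 - oneSubId K) * (∑ k ∈ Finset.range (u.1.length + 1), oneSubId K ^ k)).ofConv (G K u) := by
    refine convMul_basis_congr fun a b hab => ?_
    rw [show (toConv (antipodeMap K)).ofConv (G K b) = antipodeMap K (G K b) from rfl,
      antipodeMap_basis (show b.1.length ≤ u.1.length by omega), oneSubId, sub_sub_cancel]
  rw [h1, mul_neg_geom_sum]
  change (1 : WithConv (PQSymDual K →ₗ[K] PQSymDual K)).ofConv (G K u) -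
    (oneSubId K ^ (u.1.length + 1)).ofConv (G K u) = _
  rw [oneSubId_pow_basis _ u (by omega), sub_zero]

variable (K) in
/-- The Hopf algebra structure of `PQSym*`. -/
@[reducible] noncomputable def hopfAlgebraPQSym : HopfAlgebra K (PQSymDual K) where
  antipode := antipodeMap K
  mul_antipode_rTensor_comul := congrArg ofConv (antipodeMap_mul_id (K := K))
  mul_antipode_lTensor_comul := congrArg ofConv (id_mul_antipodeMap (K := K))

theorem isHopfAlgebra_antipodeMap : IsHopfAlgebra K (antipodeMap K) := by
  refine ⟨PQSymDual K, ringPQSym K, hopfAlgebraPQSym K, LinearEquiv.refl K (PQSymDual K),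
    fun _ _ => rfl, rfl, fun x => ?_, fun _ => rfl, fun _ => rfl⟩
  exact LinearMap.congr_fun TensorProduct.map_id _

theorem antipodeMap_of_mem {n : ℕ} {x : PQSymDual K} (hx : x ∈ homogeneous K n) :
    antipodeMap K x = ∑ k ∈ Finset.range (n + 1), (oneSubId K ^ k).ofConv x := by
  have h : homogeneous K n ≤ LinearMap.eqLocus (antipodeMap K)
      (∑ k ∈ Finset.range (n + 1), (oneSubId K ^ k).ofConv) := by
    refine Submodule.span_le.2 ?_
    rintro _ ⟨u, hu, rfl⟩
    obtain rfl : u.1.length = n := hu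
    change antipodeMap K (G K u) = _
    rw [LinearMap.sum_apply, antipodeMap, Module.Basis.constr_basis]
  have := h hx
  rw [LinearMap.mem_eqLocus, LinearMap.sum_apply] at this
  exact this

theorem oneSubId_apply (x : PQSymDual K) :
    (oneSubId K).ofConv x = CoalgebraStruct.counit (R := K) x • (1 : PQSymDual K) - x := by
  rw [← Algebra.algebraMap_eq_smul_one]
  rfl

theorem oneSubId_pow_mem_homogeneous (k : ℕ) {n : ℕ} {x : PQSymDual K}
    (hx : x ∈ homogeneous K n) : (oneSubId K ^ k).ofConv x ∈ homogeneous K n := by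
  have hone : ∀ m, ∀ y ∈ homogeneous K m,
      CoalgebraStruct.counit (R := K) y • (1 : PQSymDual K) ∈ homogeneous K m := by
    intro m y hy
    rcases eq_or_ne m 0 with rfl | hm
    · exact Submodule.smul_mem _ _ one_mem_homogeneous
    · rw [counit_homogeneous hm hy, zero_smul]
      exact Submodule.zero_mem _
  induction k generalizing n x with
  | zero =>
    rw [pow_zero]
    change algebraMap K (PQSymDual K) (CoalgebraStruct.counit (R := K) x) ∈ _
    rw [Algebra.algebraMap_eq_smul_one]
    exact hone _ _ hx
  | succ k ih =>
    rw [pow_succ]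
    change LinearMap.mul' K (PQSymDual K) (TensorProduct.map (oneSubId K ^ k).ofConv
      (oneSubId K).ofConv (CoalgebraStruct.comul (R := K) x)) ∈ _
    rw [← LinearMap.comp_apply, ← Submodule.mem_comap]
    refine SetLike.le_def.1 ?_ (comul_mem_homogeneous hx)
    refine iSup₂_le fun ij hij => ?_
    rw [Finset.HasAntidiagonal.mem_antidiagonal] at hij
    rintro _ ⟨t, rfl⟩
    rw [Submodule.mem_comap]
    induction t using TensorProduct.induction_on with
    | zero => simp
    | add s t hs ht => rw [map_add, map_add]; exact Submodule.add_mem _ hs ht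
    | tmul y z =>
      rw [← hij]
      refine mul_mem_homogeneous (ih y.2) ?_
      rw [Submodule.coe_subtype, oneSubId_apply]
      exact Submodule.sub_mem _ (hone _ _ z.2) z.2

theorem antipodeMap_mem_homogeneous {n : ℕ} {x : PQSymDual K} (hx : x ∈ homogeneous K n) :
    antipodeMap K x ∈ homogeneous K n := by
  rw [antipodeMap_of_mem hx]
  exact Submodule.sum_mem _ fun k _ => oneSubId_pow_mem_homogeneous k hx

theorem isHopfGrading_homogeneous : IsHopfGrading K (homogeneous K) (antipodeMap K) where
  isInternal := isInternal_homogeneous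
  one_mem := one_mem_homogeneous
  mul_mem _ _ _ hx _ hy := mul_mem_homogeneous hx hy
  comul_mem _ _ hx := comul_mem_homogeneous hx
  counit_eq_zero _ hn _ hx := counit_homogeneous hn hx
  antipode_mem _ _ hx := antipodeMap_mem_homogeneous hx

/-- A graded subspace that contains the unit and is stable under the product and the coproduct is
stable under the antipode. -/
theorem antipodeMap_mem {B : Submodule K (PQSymDual K)} (hone : 1 ∈ B)
    (hmul : ∀ x ∈ B, ∀ y ∈ B, x * y ∈ B)
    (hcomul : ∀ x ∈ B, CoalgebraStruct.comul (R := K) x ∈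
      LinearMap.range (TensorProduct.mapIncl B B))
    (hproj : ∀ x ∈ B, ∀ n, homogeneousProj K n x ∈ B) {x : PQSymDual K} (hx : x ∈ B) :
    antipodeMap K x ∈ B := by
  have hpow : ∀ k, ∀ x ∈ B, (oneSubId K ^ k).ofConv x ∈ B := by
    intro k
    induction k with
    | zero =>
      intro x _
      rw [pow_zero]
      change algebraMap K (PQSymDual K) (CoalgebraStruct.counit (R := K) x) ∈ _
      rw [Algebra.algebraMap_eq_smul_one]
      exact Submodule.smul_mem _ _ hone
    | succ k ih =>
      intro x hx
      rw [pow_succ]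
      change LinearMap.mul' K (PQSymDual K) (TensorProduct.map (oneSubId K ^ k).ofConv
        (oneSubId K).ofConv (CoalgebraStruct.comul (R := K) x)) ∈ _
      obtain ⟨t, ht⟩ := hcomul x hx
      rw [← ht]
      clear ht
      induction t using TensorProduct.induction_on with
      | zero => simp
      | add s t hs ht => rw [map_add, map_add, map_add]; exact Submodule.add_mem _ hs ht
      | tmul y z =>
        refine hmul _ (ih _ y.2) _ ?_
        rw [Submodule.coe_subtype, oneSubId_apply]
        exact Submodule.sub_mem _ (Submodule.smul_mem _ _ hone) z.2
  obtain ⟨N, hN⟩ := exists_sum_homogeneousProj x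
  rw [hN, map_sum]
  refine Submodule.sum_mem _ fun n _ => ?_
  rw [antipodeMap_of_mem (homogeneousProj_mem n x)]
  exact Submodule.sum_mem _ fun k _ => hpow k _ (hproj x hx n)

end Antipode

/-! ### Exchanging two adjacent segments of spots -/

/-- Exchange of the segments of values `p + 1, …, p + a` and `p + a + 1, …, p + a + b`. -/
def swapSeg (p a b v : ℕ) : ℕ :=
  if v ≤ p then v else if v ≤ p + a then v + b else if v ≤ p + a + b then v - a else v

theorem swapSeg_swapSeg (p a b v : ℕ) : swapSeg p b a (swapSeg p a b v) = v := by
  unfold swapSeg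
  split_ifs <;> omega

theorem map_swapSeg_swapSeg (p a b : ℕ) (l : List ℕ) :
    (l.map (swapSeg p a b)).map (swapSeg p b a) = l := by
  rw [List.map_map]
  conv_rhs => rw [← List.map_id l]
  exact List.map_congr_left fun v _ => swapSeg_swapSeg p a b v

theorem one_le_swapSeg {p a b v : ℕ} (h : 1 ≤ v) : 1 ≤ swapSeg p a b v := by
  unfold swapSeg
  split_ifs <;> omega

theorem pos_map_swapSeg {p a b : ℕ} {l : List ℕ} (h : ∀ c ∈ l, 1 ≤ c) :
    ∀ c ∈ l.map (swapSeg p a b), 1 ≤ c := fun c hc => by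
  obtain ⟨d, hd, rfl⟩ := List.mem_map.1 hc
  exact one_le_swapSeg (h d hd)

section CountSwap

variable (l : List ℕ) (p a b : ℕ)

theorem countLE_map_swapSeg_low {j : ℕ} (hj : j ≤ p) :
    countLE (l.map (swapSeg p a b)) j = countLE l j :=
  countLE_map _ _ _ _ fun v _ => by unfold swapSeg; split_ifs <;> omega

theorem countLE_map_swapSeg_high {j : ℕ} (hj : p + a + b ≤ j) :
    countLE (l.map (swapSeg p a b)) j = countLE l j :=
  countLE_map _ _ _ _ fun v _ => by unfold swapSeg; split_ifs <;> omega

theorem countLE_map_swapSeg_left {i : ℕ} (hi : i ≤ b) :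
    countLE (l.map (swapSeg p a b)) (p + i) + countLE l (p + a) =
      countLE l p + countLE l (p + a + i) := by
  induction l with
  | nil => rfl
  | cons v l ih =>
    simp only [List.map_cons, countLE_cons]
    have : (if swapSeg p a b v ≤ p + i then 1 else 0) + (if v ≤ p + a then 1 else 0) =
        (if v ≤ p then 1 else 0) + if v ≤ p + a + i then 1 else 0 := by
      unfold swapSeg
      split_ifs <;> omega
    omega

theorem countLE_map_swapSeg_right {i : ℕ} (hi : i ≤ a) :
    countLE (l.map (swapSeg p a b)) (p + b + i) + countLE l (p + a) =
      countLE l (p + i) + countLE l (p + a + b) := by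
  induction l with
  | nil => rfl
  | cons v l ih =>
    simp only [List.map_cons, countLE_cons]
    have : (if swapSeg p a b v ≤ p + b + i then 1 else 0) + (if v ≤ p + a then 1 else 0) =
        (if v ≤ p + i then 1 else 0) + if v ≤ p + a + b then 1 else 0 := by
      unfold swapSeg
      split_ifs <;> omega
    omega

end CountSwap

/-- The cars with preferences `l` may be parked separately in the first `p` spots, in the next `a`
spots and in the next `b` spots. -/
structure IsSplit (l : List ℕ) (p a b : ℕ) : Prop where
  pos : ∀ c ∈ l, 1 ≤ c
  fits_init : Fits l 0 p
  fits_left : Fits l p (p + a)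
  fits_right : Fits l (p + a) (p + a + b)

/-- `Fits` only depends on the numbers of letters with given values in the segment, up to a shift of
these values. -/
theorem Fits.of_countLE {l l' : List ℕ} {p q p' : ℕ} (h : Fits l p q) {d : ℕ}
    (hc : ∀ i, p + i ≤ q → countLE l' (p' + i) + countLE l p = countLE l (p + i) + d) :
    Fits l' p' (p' + (q - p)) := fun j h1 h2 => by
  obtain ⟨i, rfl⟩ := Nat.exists_eq_add_of_le h1
  have hi : i ≤ q - p := by omega
  rcases le_total p q with hpq | hpq
  · have e1 := hc i (by omega)
    have e2 := hc (q - p) (by omega)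
    have e3 := h (p + i) (by omega) (by omega)
    rw [show p + (q - p) = q by omega] at e2
    omega
  · obtain rfl : i = 0 := by omega
    rw [show q - p = 0 by omega]

theorem IsSplit.swap {l : List ℕ} {p a b : ℕ} (h : IsSplit l p a b) :
    IsSplit (l.map (swapSeg p a b)) p b a where
  pos := pos_map_swapSeg h.pos
  fits_init := fun j h1 h2 => by
    rw [countLE_map_swapSeg_low _ _ _ _ le_rfl, countLE_map_swapSeg_low _ _ _ _ h2]
    exact h.fits_init j h1 h2
  fits_left := by
    have := h.fits_right.of_countLE (l' := l.map (swapSeg p a b)) (p' := p) (d := countLE l p)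
      fun i hi => by
        have := countLE_map_swapSeg_left l p a b (i := i) (by omega)
        omega
    rwa [Nat.add_sub_cancel_left] at this
  fits_right := by
    have := h.fits_left.of_countLE (l' := l.map (swapSeg p a b)) (p' := p + b)
      (d := countLE l p + countLE l (p + a + b) - countLE l (p + a)) fun i hi => by
        have := countLE_map_swapSeg_right l p a b (i := i) (by omega)
        have := countLE_mono l (show p + a ≤ p + a + b by omega)
        omega
    rwa [Nat.add_sub_cancel_left] at this

/-- Removing free spots that follow a segment in which all the cars preferring it can be parked. -/
theorem parkList_close {l : List ℕ} {q : ℕ} (hpos : ∀ c ∈ l, 1 ≤ c) (hF : Fits l 0 q) (b : ℕ)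
    (hb : countLE l (q + b) = countLE l q) :
    parkList (l.map fun v => if v ≤ q then v else v - b) = parkList l := by
  induction b generalizing l with
  | zero => congr 1; simp
  | succ b ih =>
    have hmid : ∀ i ≤ b + 1, countLE l (q + i) = countLE l q := fun i hi => by
      have := countLE_mono l (show q ≤ q + i by omega)
      have := countLE_mono l (show q + i ≤ q + (b + 1) by omega)
      omega
    have hfree : IsFree l (q + 1) := by
      rw [IsFree.iff_forall, hmid 1 (by omega)]
      have h0 := hF 0 le_rfl (by omega)
      have := countLE_eq_zero hpos
      refine ⟨by omega, fun j hj => ?_⟩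
      have := hF j (by omega) (by omega)
      omega
    have hnot : ∀ v ∈ l, v ≤ q ∨ q + (b + 1) < v := fun v hv => by
      by_contra hc
      have := countLE_lt_of_mem hv (show q < v by omega) (show v ≤ q + (b + 1) by omega)
      omega
    have hlow : ∀ j ≤ q, countLE (l.map (dec (q + 1))) j = countLE l j := fun j hj =>
      countLE_map _ _ _ _ fun v _ => by unfold dec; split_ifs <;> omega
    rw [← hfree.parkList_map_dec, ← ih (l := l.map (dec (q + 1)))]
    · rw [List.map_map]
      congr 1
      refine List.map_congr_left fun v hv => ?_
      have := hnot v hv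
      simp only [Function.comp, dec]
      split_ifs <;> omega
    · intro c hc
      obtain ⟨v, hv, rfl⟩ := List.mem_map.1 hc
      have := hpos v hv
      unfold dec
      split_ifs <;> omega
    · intro j h1 h2
      rw [hlow _ le_rfl, hlow _ h2]
      exact hF j h1 h2
    · rw [hlow _ le_rfl, ← hb]
      exact countLE_map _ _ _ _ fun v hv => by
        have := hnot v hv
        unfold dec
        split_ifs <;> omega

/-- Exchanging an empty segment with a neighbour does not change the parkization. -/
theorem IsSplit.parkList_swap {l : List ℕ} {p a b : ℕ} (h : IsSplit l p a b)
    (he : countLE l (p + a) = countLE l p ∨ countLE l (p + a + b) = countLE l (p + a)) :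
    parkList (l.map (swapSeg p a b)) = parkList l := by
  have key : ∀ {l : List ℕ} {a b : ℕ}, IsSplit l p a b →
      countLE l (p + a + b) = countLE l (p + a) →
      parkList (l.map (swapSeg p a b)) = parkList l := by
    intro l a b h he
    rw [← parkList_close h.pos (h.fits_init.trans h.fits_left (by omega)) b he,
      ← parkList_close h.swap.pos h.swap.fits_init b, List.map_map]
    · congr 1
      refine List.map_congr_left fun v hv => ?_
      have : v ≤ p + a ∨ p + a + b < v := by
        by_contra hc
        have := countLE_lt_of_mem hv (show p + a < v by omega) (show v ≤ p + a + b by omega)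
        omega
      simp only [Function.comp, swapSeg]
      split_ifs <;> omega
    · have h1 := countLE_map_swapSeg_left l p a b le_rfl
      have h2 := countLE_map_swapSeg_low l p a b le_rfl
      omega
  rcases he with he | he
  · rw [← key h.swap, map_swapSeg_swapSeg]
    rw [add_right_comm, countLE_map_swapSeg_high _ _ _ _ le_rfl]
    have := countLE_map_swapSeg_left l p a b le_rfl
    omega
  · exact key h he

section SwapInvariant

variable {K : Type*} [Field K]

/-- The realization of `x` by words is unchanged by the exchange of two adjacent segments of spots
that can be parked separately, if the cars preferring one of them are fewer than `r`. -/
def IsSwapInvariant (r : ℕ∞) (x : PQSymDual K) : Prop :=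
  ∀ l p a b, IsSplit l p a b →
    (((countLE l (p + a) - countLE l p : ℕ) : ℕ∞) < r ∨
      ((countLE l (p + a + b) - countLE l (p + a) : ℕ) : ℕ∞) < r) →
    ev K (l.map (swapSeg p a b)) x = ev K l x

/-- For `r = 1` the only exchanges are those with an empty segment. -/
theorem isSwapInvariant_one_right (x : PQSymDual K) : IsSwapInvariant 1 x := by
  intro l p a b h hc
  rw [Order.lt_one_iff, Order.lt_one_iff, Nat.cast_eq_zero, Nat.cast_eq_zero] at hc
  have := countLE_mono l (show p ≤ p + a by omega)
  have := countLE_mono l (show p + a ≤ p + a + b by omega)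
  rw [ev_congr (h.parkList_swap (by omega))]

theorem IsSwapInvariant.anti {r s : ℕ∞} (hrs : r ≤ s) {x : PQSymDual K} (h : IsSwapInvariant s x) :
    IsSwapInvariant r x := fun l p a b hl hc =>
  h l p a b hl (hc.imp (fun h => h.trans_le hrs) fun h => h.trans_le hrs)

theorem isSwapInvariant_one (r : ℕ∞) : IsSwapInvariant r (1 : PQSymDual K) :=
  fun l p a b _ _ => by simp [ev_one]

theorem IsSwapInvariant.homogeneousProj {r : ℕ∞} {x : PQSymDual K} (h : IsSwapInvariant r x)
    (n : ℕ) : IsSwapInvariant r (homogeneousProj K n x) := fun l p a b hl hc => by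
  rw [ev_homogeneousProj, ev_homogeneousProj, List.length_map, h l p a b hl hc]

theorem IsSplit.of_sublist {l l' : List ℕ} (hs : l.Sublist l') {p a b : ℕ} (h : IsSplit l' p a b) :
    IsSplit l p a b where
  pos c hc := h.pos c (hs.subset hc)
  fits_init := h.fits_init.of_sublist hs
  fits_left := h.fits_left.of_sublist hs
  fits_right := h.fits_right.of_sublist hs

theorem IsSwapInvariant.of_sublist {r : ℕ∞} {x : PQSymDual K} (hx : IsSwapInvariant r x)
    {l l' : List ℕ} (hs : l.Sublist l') {p a b : ℕ} (h : IsSplit l' p a b)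
    (hc : ((countLE l' (p + a) - countLE l' p : ℕ) : ℕ∞) < r ∨
      ((countLE l' (p + a + b) - countLE l' (p + a) : ℕ) : ℕ∞) < r) :
    ev K (l.map (swapSeg p a b)) x = ev K l x := by
  refine hx l p a b (h.of_sublist hs) (hc.imp (fun h => lt_of_le_of_lt ?_ h)
    fun h => lt_of_le_of_lt ?_ h)
  · have := countLE_add_le_of_sublist hs (show p ≤ p + a by omega)
    exact_mod_cast show _ ≤ _ by omega
  · have := countLE_add_le_of_sublist hs (show p + a ≤ p + a + b by omega)
    exact_mod_cast show _ ≤ _ by omega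

/-- The exchanges commute with taking a prefix or a suffix of a word, which does not increase the
number of cars in a segment. -/
theorem IsSwapInvariant.mul {r : ℕ∞} {x y : PQSymDual K} (hx : IsSwapInvariant r x)
    (hy : IsSwapInvariant r y) : IsSwapInvariant r (x * y) := by
  intro l p a b h hc
  rw [ev_mul, ev_mul, splitSum_map]
  refine splitSum_congr fun k => ?_
  rw [hx.of_sublist (List.take_sublist k l) h hc, hy.of_sublist (List.drop_sublist k l) h hc]

/-- The functional `ev b` applied to the right tensor factor. -/
noncomputable def sliceRight (b : List ℕ) : PQSymDual K ⊗[K] PQSymDual K →ₗ[K] PQSymDual K :=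
  (TensorProduct.rid K (PQSymDual K)).toLinearMap ∘ₗ (ev K b).lTensor (PQSymDual K)

/-- The functional `ev a` applied to the left tensor factor. -/
noncomputable def sliceLeft (a : List ℕ) : PQSymDual K ⊗[K] PQSymDual K →ₗ[K] PQSymDual K :=
  (TensorProduct.lid K (PQSymDual K)).toLinearMap ∘ₗ (ev K a).rTensor (PQSymDual K)

theorem ev_sliceRight (a b : List ℕ) (t : PQSymDual K ⊗[K] PQSymDual K) :
    ev K a (sliceRight b t) = ev₂ K a b t := by
  have : ev K a ∘ₗ sliceRight b = ev₂ K a b :=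
    TensorProduct.ext' fun x y => by simp [sliceRight, mul_comm]
  exact LinearMap.congr_fun this t

theorem ev_sliceLeft (a b : List ℕ) (t : PQSymDual K ⊗[K] PQSymDual K) :
    ev K b (sliceLeft a t) = ev₂ K a b t := by
  have : ev K b ∘ₗ sliceLeft a = ev₂ K a b :=
    TensorProduct.ext' fun x y => by simp [sliceLeft]
  exact LinearMap.congr_fun this t

/-- Over a field, a tensor whose slices all belong to a subspace `B` belongs to `B ⊗ B`. -/
theorem mem_range_mapIncl {B : Submodule K (PQSymDual K)} {t : PQSymDual K ⊗[K] PQSymDual K}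
    (hr : ∀ b, IsParking b → sliceRight b t ∈ B) (hl : ∀ a, IsParking a → sliceLeft a t ∈ B) :
    t ∈ LinearMap.range (TensorProduct.mapIncl B B) := by
  obtain ⟨P, hP⟩ := B.subtype.exists_leftInverse_of_injective B.ker_subtype
  have hPB : ∀ x (hx : x ∈ B), (P x : PQSymDual K) = x := fun x hx =>
    congrArg Subtype.val (LinearMap.congr_fun hP ⟨x, hx⟩)
  -- a projection `Q` onto `B` fixes the slices of `t`, hence `Q ⊗ Q` fixes `t`
  set Q : PQSymDual K →ₗ[K] PQSymDual K := B.subtype ∘ₗ P with hQ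
  have h1 : TensorProduct.map Q LinearMap.id t = t := by
    refine ext_ev₂ fun a b ha hb => ?_
    have h : ev₂ K a b ∘ₗ TensorProduct.map Q LinearMap.id = ev K a ∘ₗ Q ∘ₗ sliceRight b :=
      TensorProduct.ext' fun x y => by simp [sliceRight, mul_comm]
    rw [← LinearMap.comp_apply, h, LinearMap.comp_apply, LinearMap.comp_apply]
    rw [show Q (sliceRight b t) = sliceRight b t from hPB _ (hr b hb), ev_sliceRight]
  have h2 : TensorProduct.map LinearMap.id Q t = t := by
    refine ext_ev₂ fun a b ha hb => ?_
    have h : ev₂ K a b ∘ₗ TensorProduct.map LinearMap.id Q = ev K b ∘ₗ Q ∘ₗ sliceLeft a :=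
      TensorProduct.ext' fun x y => by simp [sliceLeft]
    rw [← LinearMap.comp_apply, h, LinearMap.comp_apply, LinearMap.comp_apply]
    rw [show Q (sliceLeft a t) = sliceLeft a t from hPB _ (hl a ha), ev_sliceLeft]
  refine ⟨TensorProduct.map P P t, ?_⟩
  have h3 : TensorProduct.mapIncl B B ∘ₗ TensorProduct.map P P =
      TensorProduct.map Q LinearMap.id ∘ₗ TensorProduct.map LinearMap.id Q := by
    refine TensorProduct.ext' fun x y => ?_
    simp [TensorProduct.mapIncl, hQ]
  rw [← LinearMap.comp_apply, h3, LinearMap.comp_apply, h2, h1]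

/-- The exchange of two segments in the left factor of a shifted shuffle is an exchange in the
shuffle. -/
theorem IsSwapInvariant.sliceRight_comul {r : ℕ∞} {x : PQSymDual K} (hx : IsSwapInvariant r x)
    {t : List ℕ} (ht : IsParking t) :
    IsSwapInvariant r (sliceRight t (CoalgebraStruct.comul (R := K) x)) := by
  intro l p a b h hc
  obtain ⟨N₁, hN₁⟩ := exists_forall_fits l
  obtain ⟨N₂, hN₂⟩ := exists_forall_fits (l.map (swapSeg p a b))
  obtain ⟨N, h1, h2, h3⟩ : ∃ N, N₁ ≤ N ∧ N₂ ≤ N ∧ p + a + b ≤ N :=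
    ⟨N₁ + N₂ + (p + a + b), by omega, by omega, by omega⟩
  rw [ev_sliceRight, ev_sliceRight, ev₂_comul h.pos ht.1 (hN₁ N h1).1 (hN₁ N h1).2,
    ev₂_comul h.swap.pos ht.1 (hN₂ N h2).1 (hN₂ N h2).2]
  have hfix : t.map (· + N) = (t.map (· + N)).map (swapSeg p a b) := by
    rw [List.map_map]
    refine List.map_congr_left fun v hv => ?_
    have := ht.1 v hv
    simp only [Function.comp, swapSeg]
    split_ifs <;> omega
  -- the letters of `t` are moved beyond the segments, and are fixed by the exchange
  rw [hfix, shuffleSum_map, ← hfix]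
  refine shuffleSum_congr fun w hw => ?_
  have hcount : ∀ j ≤ N, countLE w j = countLE l j := fun j hj => by
    rw [hw.countLE, countLE_map_add_eq_zero ht.1 hj, add_zero]
  have hfits : ∀ p q, q ≤ N → Fits l p q → Fits w p q := fun p q hq hF j h1 h2 => by
    rw [hcount q hq, hcount j (h2.trans hq)]
    exact hF j h1 h2
  refine hx w p a b ⟨?_, hfits _ _ (by omega) h.fits_init, hfits _ _ (by omega) h.fits_left,
    hfits _ _ (by omega) h.fits_right⟩ ?_
  · intro c hc
    rcases hw.mem_iff.1 hc with hc | hc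
    · exact h.pos c hc
    · obtain ⟨d, hd, rfl⟩ := List.mem_map.1 hc
      have := ht.1 d hd
      omega
  · rwa [hcount _ (by omega), hcount _ (by omega), hcount _ (by omega)]

/-- The exchange of two segments in the right factor of a shifted shuffle is an exchange in the
shuffle, shifted by the length of the left factor. -/
theorem IsSwapInvariant.sliceLeft_comul {r : ℕ∞} {x : PQSymDual K} (hx : IsSwapInvariant r x)
    {t : List ℕ} (ht : IsParking t) :
    IsSwapInvariant r (sliceLeft t (CoalgebraStruct.comul (R := K) x)) := by
  intro l p a b h hc
  rw [ev_sliceLeft, ev_sliceLeft, ev₂_comul ht.1 h.pos (fun c => ht.le_length) ht.fits,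
    ev₂_comul ht.1 h.swap.pos (fun c => ht.le_length) ht.fits]
  set n := t.length
  have hmap : (l.map (swapSeg p a b)).map (· + n) =
      (l.map (· + n)).map (swapSeg (n + p) a b) := by
    rw [List.map_map, List.map_map]
    refine List.map_congr_left fun v hv => ?_
    simp only [Function.comp, swapSeg]
    split_ifs <;> omega
  have hfix : t = t.map (swapSeg (n + p) a b) := by
    conv_lhs => rw [← List.map_id t]
    refine List.map_congr_left fun v hv => ?_
    have := ht.le_length hv
    simp only [id, swapSeg]
    split_ifs <;> omega
  rw [hmap]
  conv_lhs => rw [hfix, shuffleSum_map]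
  refine shuffleSum_congr fun w hw => ?_
  have hcount : ∀ j, countLE w (n + j) = n + countLE l j := fun j => by
    rw [hw.countLE, countLE_map_add,
      countLE_eq_length fun c hc => (ht.le_length hc).trans (by omega)]
  have hfits : ∀ p q, Fits l p q → Fits w (n + p) (n + q) := fun p q hF j h1 h2 => by
    obtain ⟨i, rfl⟩ : ∃ i, j = n + i := ⟨j - n, by omega⟩
    have := hF i (by omega) (by omega)
    rw [hcount, hcount]
    omega
  have hinit : Fits w 0 n := fun j h1 h2 => by
    have hz := countLE_map_add_eq_zero h.pos (le_refl n)
    have hz' := countLE_map_add_eq_zero h.pos h2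
    rw [hw.countLE, hw.countLE, hz, hz']
    exact ht.fits j h1 h2
  refine hx w (n + p) a b ⟨?_, hinit.trans (hfits _ _ h.fits_init) (by omega), ?_, ?_⟩ ?_
  · intro c hc
    rcases hw.mem_iff.1 hc with hc | hc
    · exact ht.1 c hc
    · obtain ⟨d, hd, rfl⟩ := List.mem_map.1 hc
      have := h.pos d hd
      omega
  · rw [add_assoc]
    exact hfits _ _ h.fits_left
  · rw [add_assoc, add_assoc]
    exact hfits _ _ h.fits_right
  · have e1 := hcount (p + a)
    have e2 := hcount (p + a + b)
    rw [← add_assoc] at e1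
    rw [← add_assoc, ← add_assoc] at e2
    rw [e1, e2, hcount, Nat.add_sub_add_left, Nat.add_sub_add_left]
    exact hc

/-- The coproduct of an element invariant under all exchanges is symmetric: exchanging the two
segments occupied by the two factors of a shifted shuffle exchanges the two tensor factors. -/
theorem IsSwapInvariant.comm_comul {x : PQSymDual K} (hx : IsSwapInvariant ⊤ x) :
    TensorProduct.comm K _ _ (CoalgebraStruct.comul (R := K) x) =
      CoalgebraStruct.comul (R := K) x := by
  refine ext_ev₂ fun u v hu hv => ?_
  rw [ev₂_comm, ev₂_comul hu.1 hv.1 (fun c => hu.le_length) hu.fits,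
    ev₂_comul hv.1 hu.1 (fun c => hv.le_length) hv.fits, shuffleSum_comm]
  have h1 : u.map (· + v.length) = u.map (swapSeg 0 u.length v.length) := by
    refine List.map_congr_left fun c hc => ?_
    have := hu.le_length hc
    have := hu.1 c hc
    simp only [swapSeg]
    split_ifs <;> omega
  have h2 : v = (v.map (· + u.length)).map (swapSeg 0 u.length v.length) := by
    rw [List.map_map]
    conv_lhs => rw [← List.map_id v]
    refine List.map_congr_left fun c hc => ?_
    have := hv.le_length hc
    have := hv.1 c hc
    simp only [Function.comp, id, swapSeg]
    split_ifs <;> omega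
  rw [h1]
  conv_lhs => rw [h2, List.length_map, List.length_map, shuffleSum_map]
  refine shuffleSum_congr fun w hw => ?_
  refine hx w 0 u.length v.length ?_ (Or.inl (ENat.natCast_lt_top _))
  have hp := isParking_of_isShiftedShuffle hu hv hw
  have hc : countLE w u.length = u.length := by
    rw [hw.countLE, countLE_map_add_eq_zero hv.1 le_rfl,
      countLE_eq_length fun c hc => hu.le_length hc, add_zero]
  have hlen := hw.length
  rw [List.length_map] at hlen
  have hF := hp.fits
  refine ⟨hp.1, Fits.refl _ _, fun j _ h2 => ?_, ?_⟩
  · have := hp.le_countLE (i := j) (by omega)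
    rw [zero_add, hc]
    omega
  · rw [zero_add, ← hlen]
    exact hF.mono_left (by omega)

end SwapInvariant

/-! ### Noncommutativity and noncocommutativity -/

section Examples

variable {K : Type*} [Field K]

/-- As the exchange of segments is reversible, the invariance of a basis element needs to be checked
only on the words it contains. -/
theorem isSwapInvariant_basis {r : ℕ∞} {u : ParkingFunction}
    (h : ∀ l p a b, IsSplit l p a b →
      (((countLE l (p + a) - countLE l p : ℕ) : ℕ∞) < r ∨
        ((countLE l (p + a + b) - countLE l (p + a) : ℕ) : ℕ∞) < r) →
      parkList l = u.1 → parkList (l.map (swapSeg p a b)) = u.1) :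
    IsSwapInvariant r (G K u) := by
  intro l p a b hl hc
  rw [ev_basis, ev_basis]
  congr 1
  refine propext ⟨fun h' => ?_, h l p a b hl hc⟩
  have := h _ p b a hl.swap ?_ h'
  · rwa [map_swapSeg_swapSeg] at this
  · have e1 := countLE_map_swapSeg_left l p a b le_rfl
    have e2 := countLE_map_swapSeg_low l p a b le_rfl
    have e3 := countLE_map_swapSeg_high l p a b le_rfl
    have h1 := countLE_mono l (show p ≤ p + a by omega)
    have h2 := countLE_mono l (show p + a ≤ p + a + b by omega)
    rw [show p + b + a = p + a + b by ring, e3, e2]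
    rw [show countLE (l.map (swapSeg p a b)) (p + b) - countLE l p =
      countLE l (p + a + b) - countLE l (p + a) by omega,
      show countLE l (p + a + b) - countLE (l.map (swapSeg p a b)) (p + b) =
      countLE l (p + a) - countLE l p by omega]
    exact hc.symm

/-- The parking function `1ⁿ`. -/
def onesPF (n : ℕ) : ParkingFunction :=
  ⟨List.replicate n 1, fun a ha => (List.eq_of_mem_replicate ha).ge, fun i h1 h2 => by
    rw [countLE_eq_length fun a ha => (List.eq_of_mem_replicate ha).trans_le h1]
    exact h2⟩

theorem slot_injOn {l : List ℕ} (hl : ∀ a ∈ l, 1 ≤ a) {v w : ℕ} (hv : v ∈ l) (hw : w ∈ l)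
    (h : slot l v = slot l w) : v = w := by
  rcases lt_trichotomy v w with hlt | heq | hlt
  · exact absurd h (slot_lt_slot hv (hl v hv) hlt).ne
  · exact heq
  · exact absurd h (slot_lt_slot hw (hl w hw) hlt).ne'

theorem parkList_replicate {n d : ℕ} (hd : 1 ≤ d) :
    parkList (List.replicate n d) = List.replicate n 1 := by
  rw [parkList_eq_map_slot, List.map_replicate]
  congr 1
  have h1 := one_le_slot (List.replicate n d) hd
  have h2 := slot_le_countLE_add (List.replicate n d) (show d - 1 < d by omega)
  rw [countLE_eq_zero fun a ha => by have := List.eq_of_mem_replicate ha; omega] at h2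
  omega

/-- The words with parkization `1ⁿ` are those with `n` equal letters. -/
theorem isSwapInvariant_basis_onesPF (r : ℕ∞) (n : ℕ) : IsSwapInvariant r (G K (onesPF n)) := by
  refine isSwapInvariant_basis fun l p a b hl _ h => ?_
  have hlen : l.length = n := by
    rw [← length_parkList, h]
    exact List.length_replicate
  rcases l with _ | ⟨c, l⟩
  · exact h
  have hc : c :: l = List.replicate n c := by
    refine List.eq_replicate_iff.2 ⟨hlen, fun d hd => ?_⟩
    have hs : ∀ e ∈ c :: l, slot (c :: l) e = 1 := fun e he => by
      have : slot (c :: l) e ∈ parkList (c :: l) := by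
        rw [parkList_eq_map_slot]
        exact List.mem_map_of_mem he
      rw [h] at this
      exact List.eq_of_mem_replicate this
    exact slot_injOn hl.pos hd (by simp) ((hs d hd).trans (hs c (by simp)).symm)
  rw [hc, List.map_replicate]
  exact parkList_replicate (one_le_swapSeg (hl.pos c (by simp)))

theorem basis_onesPF_not_commute :
    G K (onesPF 1) * G K (onesPF 2) ≠ G K (onesPF 2) * G K (onesPF 1) := by
  intro h
  -- the word `211` occurs in the first product only
  have h1 := congrArg (ev K [2, 1, 1]) h
  rw [ev_basis_mul_basis, ev_basis_mul_basis, if_pos, if_neg] at h1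
  · exact one_ne_zero h1
  · rw [parkList_eq_map_slot, parkList_eq_map_slot]
    decide
  · rw [parkList_eq_map_slot, parkList_eq_map_slot]
    decide

/-- The parking function whose columns are `1ᵐ` and `1ⁿ`, in this order from left to right. -/
def twoColumnsPF (m n : ℕ) : ParkingFunction :=
  ⟨List.replicate m 1 ++ (List.replicate n 1).map (· + m), by
    have h := isParking_of_isShiftedShuffle (onesPF m).2 (onesPF n).2
      (IsShuffle.append _ ((onesPF n).1.map (· + (onesPF m).1.length)))
    simpa [onesPF] using h⟩

theorem countLE_add_count_le {l : List ℕ} {i j v : ℕ} (h1 : i < v) (h2 : v ≤ j) :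
    countLE l i + l.count v ≤ countLE l j := by
  induction l with
  | nil => simp [countLE]
  | cons a l ih =>
    rw [countLE_cons, countLE_cons, List.count_cons]
    simp only [beq_iff_eq]
    split_ifs <;> omega

theorem exists_mem_of_countLE_lt {l : List ℕ} {i j : ℕ} (h : countLE l i < countLE l j) :
    ∃ v ∈ l, i < v ∧ v ≤ j := by
  by_contra hc
  push Not at hc
  refine h.not_ge ?_
  unfold countLE
  refine List.countP_mono_left fun v hv => ?_
  have := hc v hv
  simp only [decide_eq_true_eq]
  omega

/-- In a word whose letters all occur at least `r` times, each segment of spots is preferred by no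
car or by at least `r` cars. -/
theorem isSwapInvariant_basis_of_count {r : ℕ} {u : ParkingFunction}
    (hu : ∀ v ∈ u.1, r ≤ u.1.count v) : IsSwapInvariant r (G K u) := by
  refine isSwapInvariant_basis fun l p a b hl hc h => ?_
  have hcount : ∀ v ∈ l, r ≤ l.count v := fun v hv => by
    have hmem : slot l v ∈ u.1 := by
      rw [← h, parkList_eq_map_slot]
      exact List.mem_map_of_mem hv
    refine (hu _ hmem).trans_eq ?_
    rw [← h, parkList_eq_map_slot, List.count, List.countP_map, List.count]
    refine List.countP_congr fun w hw => ?_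
    simp only [Function.comp, beq_iff_eq]
    exact ⟨fun h => slot_injOn hl.pos hw hv h, fun h => by rw [h]⟩
  have hseg : ∀ i j, i ≤ j → countLE l j - countLE l i < r → countLE l j = countLE l i := by
    intro i j hij hlt
    by_contra hne
    have := countLE_mono l hij
    obtain ⟨v, hv, h1, h2⟩ := exists_mem_of_countLE_lt (show countLE l i < countLE l j by omega)
    have := countLE_add_count_le (l := l) h1 h2
    have := hcount v hv
    omega
  rw [hl.parkList_swap, h]
  exact hc.imp (fun h => hseg _ _ (by omega) (by exact_mod_cast h))
    fun h => hseg _ _ (by omega) (by exact_mod_cast h)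

theorem le_count_twoColumnsPF (r v : ℕ) (hv : v ∈ (twoColumnsPF r (r + 1)).1) :
    r ≤ (twoColumnsPF r (r + 1)).1.count v := by
  simp only [twoColumnsPF, List.map_replicate, List.mem_append, List.mem_replicate,
    List.count_append, List.count_replicate, beq_iff_eq] at hv ⊢
  split_ifs <;> omega

/-- The coproduct of `G_u`, with `u` having the columns `1ʳ` and `1ʳ⁺¹` in this order, contains
`G_{1ʳ} ⊗ G_{1ʳ⁺¹}` but not `G_{1ʳ⁺¹} ⊗ G_{1ʳ}`. -/
theorem comm_comul_basis_twoColumnsPF_ne {r : ℕ} (hr : 1 ≤ r) :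
    TensorProduct.comm K _ _ (CoalgebraStruct.comul (R := K) (G K (twoColumnsPF r (r + 1)))) ≠
      CoalgebraStruct.comul (R := K) (G K (twoColumnsPF r (r + 1))) := by
  classical
  intro h
  have h1 := congrArg (ev₂ K (onesPF r).1 (onesPF (r + 1)).1) h
  rw [ev₂_comm, ev₂_comul_basis _ _ _ (onesPF _).2 (onesPF _).2,
    ev₂_comul_basis _ _ _ (onesPF _).2 (onesPF _).2, if_neg, if_pos] at h1
  · exact zero_ne_one h1
  · have h := IsShuffle.append (List.replicate r 1) ((List.replicate (r + 1) 1).map (· + r))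
    simpa [IsShiftedShuffle, onesPF, twoColumnsPF] using h
  · intro h
    -- compare the numbers of letters `1`
    have h2 := IsShuffle.countLE h 1
    have h3 : countLE (twoColumnsPF r (r + 1)).1 1 = r := by
      rw [twoColumnsPF, countLE_append,
        countLE_eq_length fun a ha => (List.eq_of_mem_replicate ha).le, List.length_replicate,
        countLE_eq_zero fun a ha => ?_, add_zero]
      obtain ⟨c, hc, rfl⟩ := List.mem_map.1 ha
      have := List.eq_of_mem_replicate hc
      omega
    have h4 : countLE (onesPF (r + 1)).1 1 = r + 1 := by
      rw [onesPF, countLE_eq_length fun a ha => (List.eq_of_mem_replicate ha).le,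
        List.length_replicate]
    omega

end Examples

/-! ### Counting letters -/

theorem countLE_ofFn {n : ℕ} (f : Fin n → ℕ) (i : ℕ) :
    countLE (List.ofFn f) i = (Finset.univ.filter fun k => f k ≤ i).card := by
  unfold countLE
  rw [← Multiset.coe_countP, ← Fin.univ_val_map, Multiset.countP_map]
  simp [Finset.card, Finset.filter]

/-- Among the elements of `L` in increasing order, `p` has index the number of smaller elements. -/
theorem orderEmbOfFin_card_filter_lt {L : Finset ℕ} {p : ℕ} (hp : p ∈ L)
    (h : (L.filter (· < p)).card < L.card) :
    L.orderEmbOfFin rfl ⟨(L.filter (· < p)).card, h⟩ = p := by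
  obtain ⟨k, rfl⟩ : ∃ k, L.orderEmbOfFin rfl k = p := by
    have : p ∈ Set.range (L.orderEmbOfFin rfl) := by simpa using hp
    exact this
  congr 1
  refine Fin.ext ?_
  have : L.filter (· < L.orderEmbOfFin rfl k) =
      (Finset.univ.filter (· < k)).map (L.orderEmbOfFin rfl).toEmbedding := by
    ext q
    simp only [Finset.mem_filter, Finset.mem_map, Finset.mem_univ, true_and]
    constructor
    · rintro ⟨hq, hlt⟩
      obtain ⟨k', rfl⟩ : ∃ k, L.orderEmbOfFin rfl k = q := by
        have : q ∈ Set.range (L.orderEmbOfFin rfl) := by simpa using hq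
        exact this
      exact ⟨k', (L.orderEmbOfFin rfl).lt_iff_lt.1 hlt, rfl⟩
    · rintro ⟨k', hk', rfl⟩
      exact ⟨Finset.orderEmbOfFin_mem _ _ _, (L.orderEmbOfFin rfl).lt_iff_lt.2 hk'⟩
  change (L.filter (· < L.orderEmbOfFin rfl k)).card = (k : ℕ)
  rw [this, Finset.card_map]
  exact (congrArg Finset.card (by ext; simp)).trans (Fin.card_Iio k)

theorem card_filter_orderEmbOfFin (L : Finset ℕ) (P : ℕ → Prop) [DecidablePred P] :
    (Finset.univ.filter fun k => P (L.orderEmbOfFin rfl k)).card = (L.filter P).card := by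
  rw [← Finset.card_map (L.orderEmbOfFin rfl).toEmbedding]
  congr 1
  ext q
  simp only [Finset.mem_filter, Finset.mem_map, Finset.mem_univ, true_and]
  constructor
  · rintro ⟨k, hk, rfl⟩
    exact ⟨Finset.orderEmbOfFin_mem _ _ _, hk⟩
  · rintro ⟨hq, hP⟩
    obtain ⟨k, rfl⟩ : ∃ k, L.orderEmbOfFin rfl k = q := by
      have : q ∈ Set.range (L.orderEmbOfFin rfl) := by simpa using hq
      exact this
    exact ⟨k, hP, rfl⟩

theorem countLE_eq_card (l : List ℕ) (i : ℕ) :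
    countLE l i = ((Finset.range l.length).filter fun p => l.getD p 0 ≤ i).card := by
  conv_lhs => rw [show l = List.ofFn fun k : Fin l.length => l.getD k 0 by
    refine List.ext_getElem (by simp) fun p h1 h2 => by simp]
  rw [countLE_ofFn, ← Finset.card_map Fin.valEmbedding]
  congr 1
  ext p
  simp only [Finset.mem_filter, Finset.mem_map, Finset.mem_univ, true_and, Finset.mem_range,
    Fin.valEmbedding_apply]
  exact ⟨fun ⟨k, hk, h⟩ => h ▸ ⟨k.2, hk⟩, fun ⟨h1, h2⟩ => ⟨⟨p, h1⟩, h2, rfl⟩⟩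

theorem countLE_add_card (l : List ℕ) {i j : ℕ} (hij : i ≤ j) :
    countLE l i + ((Finset.range l.length).filter
      fun p => i < l.getD p 0 ∧ l.getD p 0 ≤ j).card = countLE l j := by
  rw [countLE_eq_card, countLE_eq_card, ← Finset.card_union_of_disjoint]
  · congr 1
    ext p
    simp only [Finset.mem_union, Finset.mem_filter]
    constructor
    · rintro (⟨h1, h2⟩ | ⟨h1, h2, h3⟩)
      · exact ⟨h1, h2.trans hij⟩
      · exact ⟨h1, h3⟩
    · rintro ⟨h1, h2⟩
      by_cases h : l.getD p 0 ≤ i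
      · exact Or.inl ⟨h1, h⟩
      · exact Or.inr ⟨h1, by omega, h2⟩
  · rw [Finset.disjoint_left]
    intro p h1 h2
    rw [Finset.mem_filter] at h1 h2
    omega

namespace BiWord

/-! ### The word of a bi-word -/

/-- The number of spots of the column `j`. -/
def width (m : BiWord) (j : ℕ) : ℕ := max 1 (m.L j).card

/-- The number of spots of the columns before the column `j`. -/
def start (m : BiWord) (j : ℕ) : ℕ := ∑ q ∈ Finset.range j, m.width q

theorem start_succ (m : BiWord) (j : ℕ) : m.start (j + 1) = m.start j + m.width j :=
  Finset.sum_range_succ _ _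

theorem start_mono (m : BiWord) : Monotone m.start :=
  monotone_nat_of_le_succ fun j => by rw [start_succ]; omega

theorem col_eq (m : BiWord) {p : Fin m.n} {j : ℕ} (h : (p : ℕ) ∈ m.L j) : m.col p = j := by
  by_contra hne
  exact Finset.disjoint_left.1 (m.disjoint _ _ hne) (m.mem_col p) h

theorem letter_eq (m : BiWord) {p : Fin m.n} {j : ℕ} (h : (p : ℕ) ∈ m.L j) :
    m.letter p = (m.M j).getD ((m.L j).filter (· < (p : ℕ))).card 0 + m.start j := by
  obtain rfl := m.col_eq h
  rw [letter, List.getD_eq_getElem _ _ (m.rank_lt h)]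
  rfl

theorem start_lt_letter (m : BiWord) {p : Fin m.n} {j : ℕ} (h : (p : ℕ) ∈ m.L j) :
    m.start j < m.letter p := by
  rw [m.letter_eq h, List.getD_eq_getElem _ _ (m.rank_lt h)]
  have := (m.prime j).1.1 _ (List.getElem_mem (m.rank_lt h))
  omega

theorem letter_le (m : BiWord) {p : Fin m.n} {j : ℕ} (h : (p : ℕ) ∈ m.L j) :
    m.letter p ≤ m.start (j + 1) := by
  rw [m.letter_eq h, List.getD_eq_getElem _ _ (m.rank_lt h), start_succ]
  have := (m.prime j).1.le_length (List.getElem_mem (m.rank_lt h))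
  rw [m.length_eq] at this
  unfold width
  omega

theorem mem_L_iff (m : BiWord) (p : Fin m.n) (j : ℕ) :
    (p : ℕ) ∈ m.L j ↔ m.start j < m.letter p ∧ m.letter p ≤ m.start (j + 1) := by
  refine ⟨fun h => ⟨m.start_lt_letter h, m.letter_le h⟩, fun ⟨h1, h2⟩ => ?_⟩
  have h3 := m.start_lt_letter (m.mem_col p)
  have h4 := m.letter_le (m.mem_col p)
  have hc : m.col p = j := by
    rcases lt_trichotomy (m.col p) j with h | h | h
    · have := m.start_mono (show m.col p + 1 ≤ j from h)
      omega
    · exact h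
    · have := m.start_mono (show j + 1 ≤ m.col p from h)
      omega
  exact hc ▸ m.mem_col p

theorem length_toWord (m : BiWord) : m.toWord.1.length = m.n := List.length_ofFn

theorem getD_toWord (m : BiWord) (p : Fin m.n) : m.toWord.1.getD p 0 = m.letter p := by
  rw [List.getD_eq_getElem _ _ (by rw [length_toWord]; exact p.2)]
  simp [toWord]

theorem lt_of_mem_L (m : BiWord) {p j : ℕ} (h : p ∈ m.L j) : p < m.n := (m.cover p).1 ⟨j, h⟩

theorem L_eq_filter (m : BiWord) (j : ℕ) :
    m.L j = (Finset.range m.toWord.1.length).filter fun p =>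
      m.start j < m.toWord.1.getD p 0 ∧ m.toWord.1.getD p 0 ≤ m.start (j + 1) := by
  ext p
  rw [Finset.mem_filter, length_toWord, Finset.mem_range]
  constructor
  · intro h
    have hp := m.lt_of_mem_L h
    refine ⟨hp, ?_⟩
    rw [m.getD_toWord ⟨p, hp⟩]
    exact (m.mem_L_iff ⟨p, hp⟩ j).1 h
  · rintro ⟨hp, h⟩
    rw [m.getD_toWord ⟨p, hp⟩] at h
    exact (m.mem_L_iff ⟨p, hp⟩ j).2 h

theorem countLE_start_succ (m : BiWord) (j : ℕ) :
    countLE m.toWord.1 (m.start (j + 1)) = countLE m.toWord.1 (m.start j) + (m.L j).card := by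
  conv_rhs => rw [L_eq_filter]
  exact (countLE_add_card _ (m.start_mono (Nat.le_succ j))).symm

/-- The letters of `M_j` are those of the encoded word in the column `j`, decreased by `m.start j`. -/
theorem countLE_M (m : BiWord) (j : ℕ) {i : ℕ} (hi : i ≤ m.width j) :
    countLE m.toWord.1 (m.start j + i) =
      countLE m.toWord.1 (m.start j) + countLE (m.M j) i := by
  rw [← countLE_add_card _ (show m.start j ≤ m.start j + i by omega)]
  congr 1
  have hM : m.M j = List.ofFn fun k : Fin (m.L j).card =>
      m.toWord.1.getD ((m.L j).orderEmbOfFin rfl k) 0 - m.start j := by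
    refine List.ext_getElem (by rw [m.length_eq, List.length_ofFn]) fun k h1 h2 => ?_
    have hk : k < (m.L j).card := by rwa [← m.length_eq]
    rw [List.getElem_ofFn]
    have hmem := Finset.orderEmbOfFin_mem (m.L j) rfl ⟨k, hk⟩
    have hlt := m.lt_of_mem_L hmem
    rw [m.getD_toWord ⟨_, hlt⟩, m.letter_eq (j := j) hmem, Nat.add_sub_cancel]
    have hr := m.rank_lt hmem
    rw [m.length_eq] at hr
    have := orderEmbOfFin_card_filter_lt hmem hr
    have := congrArg Fin.val ((m.L j).orderEmbOfFin rfl |>.injective this)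
    simp only at this
    rw [this, List.getD_eq_getElem _ _ h1]
  rw [hM, countLE_ofFn,
    card_filter_orderEmbOfFin (m.L j) (fun q => m.toWord.1.getD q 0 - m.start j ≤ i)]
  congr 1
  ext p
  conv_rhs => rw [L_eq_filter]
  simp only [Finset.mem_filter]
  have := m.start_succ j
  constructor
  · rintro ⟨h1, h2, h3⟩
    exact ⟨⟨h1, h2, by omega⟩, by omega⟩
  · rintro ⟨⟨h1, h2, h3⟩, h4⟩
    exact ⟨h1, h2, by omega⟩

theorem fits_column (m : BiWord) (j : ℕ) : Fits m.toWord.1 (m.start j) (m.start (j + 1)) := by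
  intro i h1 h2
  obtain ⟨i, rfl⟩ := Nat.exists_eq_add_of_le h1
  have hs := m.start_succ j
  rw [m.countLE_start_succ, m.countLE_M j (by omega), hs]
  have hw : m.width j = max 1 (m.L j).card := rfl
  by_cases hi : i ≤ (m.L j).card
  · have := (m.prime j).1.le_countLE (i := i) (by rw [m.length_eq]; exact hi)
    omega
  · omega

theorem fits_start (m : BiWord) (j : ℕ) : Fits m.toWord.1 0 (m.start j) := by
  induction j with
  | zero => exact Fits.refl _ _
  | succ j ih => exact ih.trans (m.fits_column j) (m.start_mono (Nat.le_succ j))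

theorem isSplit_toWord (m : BiWord) (i : ℕ) :
    IsSplit m.toWord.1 (m.start i) (m.width i) (m.width (i + 1)) where
  pos := m.toWord.2
  fits_init := m.fits_start i
  fits_left := by
    rw [← start_succ]
    exact m.fits_column i
  fits_right := by
    rw [← start_succ, ← start_succ]
    exact m.fits_column (i + 1)

theorem exchange_start_le (m : BiWord) {i j : ℕ} (hj : j ≤ i) :
    (m.exchange i).start j = m.start j := by
  refine Finset.sum_congr rfl fun q hq => ?_
  rw [Finset.mem_range] at hq
  simp only [width, exchange]
  rw [Equiv.swap_apply_of_ne_of_ne (by omega) (by omega)]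

theorem exchange_width_left (m : BiWord) (i : ℕ) :
    (m.exchange i).width i = m.width (i + 1) := by
  simp [width, exchange]

theorem exchange_width_right (m : BiWord) (i : ℕ) :
    (m.exchange i).width (i + 1) = m.width i := by
  simp [width, exchange]

theorem exchange_start_ge (m : BiWord) {i j : ℕ} (hj : i + 2 ≤ j) :
    (m.exchange i).start j = m.start j := by
  induction j, hj using Nat.le_induction with
  | base =>
    rw [start_succ, start_succ, exchange_width_left, exchange_width_right,
      m.exchange_start_le le_rfl, m.start_succ (i + 1), m.start_succ i]
    omega
  | succ j hj ih =>
    rw [start_succ, start_succ, ih]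
    congr 1
    simp only [width, exchange]
    rw [Equiv.swap_apply_of_ne_of_ne (by omega) (by omega)]

theorem letter_exchange (m : BiWord) (i : ℕ) (p : Fin m.n) :
    (m.exchange i).letter p = swapSeg (m.start i) (m.width i) (m.width (i + 1)) (m.letter p) := by
  obtain ⟨c, hp⟩ : ∃ c, (p : ℕ) ∈ m.L c := ⟨_, m.mem_col p⟩
  have hp' : (p : ℕ) ∈ (m.exchange i).L (Equiv.swap i (i + 1) c) := by
    simpa [exchange] using hp
  have h1 := m.letter_eq hp
  have h2 := (m.exchange i).letter_eq (p := p) hp'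
  have hM : (m.exchange i).M (Equiv.swap i (i + 1) c) = m.M c := by simp [exchange]
  have hL : (m.exchange i).L (Equiv.swap i (i + 1) c) = m.L c := by simp [exchange]
  rw [hM, hL] at h2
  have h3 := m.start_lt_letter hp
  have h4 := m.letter_le hp
  have e1 := m.start_succ i
  have e2 := m.start_succ (i + 1)
  rcases lt_or_ge c i with hlt | hge
  · rw [Equiv.swap_apply_of_ne_of_ne (by omega) (by omega), m.exchange_start_le hlt.le] at h2
    have := m.start_mono (show c + 1 ≤ i from hlt)
    rw [h2, ← h1]
    unfold swapSeg
    rw [if_pos (by omega)]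
  · obtain rfl | rfl | hgt : c = i ∨ c = i + 1 ∨ i + 2 ≤ c := by omega
    · rw [Equiv.swap_apply_left, start_succ, m.exchange_start_le le_rfl, exchange_width_left] at h2
      unfold swapSeg
      rw [if_neg (by omega), if_pos (by omega)]
      omega
    · rw [Equiv.swap_apply_right, m.exchange_start_le le_rfl] at h2
      unfold swapSeg
      rw [if_neg (by omega), if_neg (by omega), if_pos (by omega)]
      omega
    · rw [Equiv.swap_apply_of_ne_of_ne (by omega) (by omega), m.exchange_start_ge hgt] at h2
      have := m.start_mono (show i + 1 + 1 ≤ c from hgt)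
      rw [h2, ← h1]
      unfold swapSeg
      rw [if_neg (by omega), if_neg (by omega), if_neg (by omega)]

/-- The exchange of two adjacent columns of a bi-word exchanges the segments of values that they
occupy in the encoded word. -/
theorem toWord_exchange (m : BiWord) (i : ℕ) : (m.exchange i).toWord.1 =
    m.toWord.1.map (swapSeg (m.start i) (m.width i) (m.width (i + 1))) := by
  simp only [toWord, List.map_ofFn]
  refine congrArg List.ofFn (funext fun p => m.letter_exchange i p)

end BiWord

/-! ### The bi-word of a word -/

section OfWord

variable (l : List ℕ)

theorem exists_segWidth (s : ℕ) : ∃ t, 1 ≤ t ∧ countLE l (s + t) ≤ countLE l s + t :=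
  ⟨l.length + 1, by omega, by have := countLE_le_length l (s + (l.length + 1)); omega⟩

/-- The least `t ≥ 1` such that the cars preferring one of the spots `s + 1, …, s + t` are at
most `t`. -/
def segWidth (s : ℕ) : ℕ := Nat.find (exists_segWidth l s)

theorem one_le_segWidth (s : ℕ) : 1 ≤ segWidth l s := (Nat.find_spec (exists_segWidth l s)).1

theorem countLE_add_segWidth (s : ℕ) : countLE l (s + segWidth l s) ≤ countLE l s + segWidth l s :=
  (Nat.find_spec (exists_segWidth l s)).2

theorem segWidth_le {s t : ℕ} (h1 : 1 ≤ t) (h2 : countLE l (s + t) ≤ countLE l s + t) :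
    segWidth l s ≤ t :=
  Nat.find_min' _ ⟨h1, h2⟩

theorem lt_countLE_of_lt_segWidth {s t : ℕ} (h1 : 1 ≤ t) (h2 : t < segWidth l s) :
    countLE l s + t < countLE l (s + t) := by
  by_contra hc
  have := segWidth_le l h1 (not_lt.1 hc)
  omega

/-- The number of spots of the columns of `l` before the column `j`. -/
def segStart : ℕ → ℕ
  | 0 => 0
  | j + 1 => segStart j + segWidth l (segStart j)

theorem segStart_succ (j : ℕ) :
    segStart l (j + 1) = segStart l j + segWidth l (segStart l j) := rfl

theorem segStart_mono : Monotone (segStart l) :=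
  monotone_nat_of_le_succ fun j => by rw [segStart_succ]; omega

theorem le_segStart (j : ℕ) : j ≤ segStart l j := by
  induction j with
  | zero => omega
  | succ j ih =>
    rw [segStart_succ]
    have := one_le_segWidth l (segStart l j)
    omega

theorem fits_segWidth (s : ℕ) : Fits l s (s + segWidth l s) := by
  intro j h1 h2
  obtain ⟨t, rfl⟩ := Nat.exists_eq_add_of_le h1
  have h3 := countLE_add_segWidth l s
  rcases Nat.eq_zero_or_pos t with rfl | ht
  · rw [add_zero]
    omega
  · rcases Nat.lt_or_ge t (segWidth l s) with h | h
    · have := lt_countLE_of_lt_segWidth l ht h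
      omega
    · obtain rfl : t = segWidth l s := by omega
      omega

/-- Any spot that no car leaves to the right is the end of a column. -/
theorem exists_segStart_eq {p : ℕ} (h : Fits l 0 p) : ∃ k, segStart l k = p := by
  have key : ∀ d k, segStart l k + d = p → ∃ k, segStart l k = p := by
    intro d
    induction d using Nat.strong_induction_on with
    | _ d ih =>
      intro k hk
      rcases Nat.eq_zero_or_pos d with rfl | hd
      · exact ⟨k, hk⟩
      · have h1 := h (segStart l k) (by omega) (by omega)
        have h2 := segWidth_le l hd (s := segStart l k) (by rw [hk]; omega)
        have h3 := one_le_segWidth l (segStart l k)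
        exact ih (d - segWidth l (segStart l k)) (by omega) (k + 1) (by rw [segStart_succ]; omega)
  exact key p 0 (by simp [segStart])

/-- The positions of the letters of `l` in the column `j`. -/
def segPos (j : ℕ) : Finset ℕ := (Finset.range l.length).filter fun p =>
  segStart l j < l.getD p 0 ∧ l.getD p 0 ≤ segStart l (j + 1)

theorem countLE_add_card_segPos (j : ℕ) :
    countLE l (segStart l j) + (segPos l j).card = countLE l (segStart l (j + 1)) :=
  countLE_add_card l (segStart_mono l (Nat.le_succ j))

theorem card_segPos_le (j : ℕ) : (segPos l j).card ≤ segWidth l (segStart l j) := by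
  have h1 := countLE_add_card_segPos l j
  have h2 := countLE_add_segWidth l (segStart l j)
  rw [segStart_succ] at h1
  omega

/-- A column has as many spots as cars, unless it is empty and has one spot. -/
theorem max_one_card_segPos (j : ℕ) : max 1 (segPos l j).card = segWidth l (segStart l j) := by
  have h1 := countLE_add_card_segPos l j
  have h2 := card_segPos_le l j
  have h3 := one_le_segWidth l (segStart l j)
  rw [segStart_succ] at h1
  rcases h3.eq_or_lt with h | h
  · omega
  · have h4 := lt_countLE_of_lt_segWidth l (s := segStart l j) (t := segWidth l (segStart l j) - 1)
      (by omega) (by omega)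
    have := countLE_mono l (show segStart l j + (segWidth l (segStart l j) - 1) ≤
      segStart l j + segWidth l (segStart l j) by omega)
    omega

/-- The letters of `l` in the column `j`, shifted so as to start from `1`. -/
def segWord (j : ℕ) : List ℕ := List.ofFn fun k : Fin (segPos l j).card =>
  l.getD ((segPos l j).orderEmbOfFin rfl k) 0 - segStart l j

theorem countLE_segWord (j : ℕ) {i : ℕ} (hi : i ≤ segWidth l (segStart l j)) :
    countLE l (segStart l j + i) = countLE l (segStart l j) + countLE (segWord l j) i := by
  rw [← countLE_add_card l (show segStart l j ≤ segStart l j + i by omega), segWord, countLE_ofFn,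
    card_filter_orderEmbOfFin (segPos l j) (fun q => l.getD q 0 - segStart l j ≤ i)]
  congr 2
  ext p
  simp only [segPos, Finset.mem_filter]
  have := segStart_succ l j
  constructor
  · rintro ⟨h1, h2, h3⟩
    exact ⟨⟨h1, h2, by omega⟩, by omega⟩
  · rintro ⟨⟨h1, h2, h3⟩, h4⟩
    exact ⟨h1, h2, by omega⟩

theorem length_segWord (j : ℕ) : (segWord l j).length = (segPos l j).card := List.length_ofFn

theorem isPrimeParking_segWord (j : ℕ) : IsPrimeParking (segWord l j) := by
  have hw := card_segPos_le l j
  have hc := countLE_add_card_segPos l j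
  rw [segStart_succ] at hc
  refine ⟨⟨fun a ha => ?_, fun i h1 h2 => ?_⟩, fun i h1 h2 => ?_⟩
  · obtain ⟨k, rfl⟩ := (List.mem_ofFn' _ _).1 ha
    have := Finset.orderEmbOfFin_mem (segPos l j) rfl k
    have := (Finset.mem_filter.1 this).2.1
    change 1 ≤ _ - _
    omega
  · rw [length_segWord] at h2
    have h3 := countLE_segWord l j (i := i) (by omega)
    rcases (h2.trans hw).eq_or_lt with h | h
    · rw [← h] at hc
      omega
    · have := lt_countLE_of_lt_segWidth l h1 h
      omega
  · rw [length_segWord] at h2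
    have h3 := countLE_segWord l j (i := i) (by omega)
    have := lt_countLE_of_lt_segWidth l (s := segStart l j) h1 (by omega)
    omega

variable {l} in
theorem exists_mem_segPos (hl : ∀ a ∈ l, 1 ≤ a) {p : ℕ} (hp : p < l.length) :
    ∃ j, p ∈ segPos l j := by
  have h1 : 1 ≤ l.getD p 0 := by
    rw [List.getD_eq_getElem _ _ hp]
    exact hl _ (List.getElem_mem hp)
  have hex : ∃ k, l.getD p 0 ≤ segStart l k := ⟨_, le_segStart l _⟩
  have h2 := Nat.find_spec hex
  obtain ⟨j, hj⟩ : ∃ j, Nat.find hex = j + 1 := by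
    refine Nat.exists_eq_add_one.2 (Nat.pos_of_ne_zero fun h0 => ?_)
    rw [h0] at h2
    change _ ≤ 0 at h2
    omega
  refine ⟨j, Finset.mem_filter.2 ⟨Finset.mem_range.2 hp, ?_, hj ▸ h2⟩⟩
  exact not_le.1 (Nat.find_min hex (show j < Nat.find hex by omega))

/-- The bi-word encoding a word on positive integers. -/
def BiWord.ofWord (w : Word) : BiWord where
  n := w.1.length
  L := segPos w.1
  M := segWord w.1
  disjoint := by
    have key : ∀ i j, i < j → Disjoint (segPos w.1 i) (segPos w.1 j) := by
      intro i j h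
      rw [Finset.disjoint_left]
      intro p h1 h2
      rw [segPos, Finset.mem_filter] at h1 h2
      have := segStart_mono w.1 (show i + 1 ≤ j from h)
      omega
    intro i j h
    rcases lt_or_gt_of_ne h with h | h
    · exact key i j h
    · exact (key j i h).symm
  cover p := ⟨fun ⟨_, hj⟩ => Finset.mem_range.1 (Finset.mem_filter.1 hj).1,
    fun hp => exists_mem_segPos w.2 hp⟩
  prime := isPrimeParking_segWord w.1
  length_eq := length_segWord w.1

theorem BiWord.width_ofWord (w : Word) (j : ℕ) :
    (BiWord.ofWord w).width j = segWidth w.1 (segStart w.1 j) := max_one_card_segPos w.1 j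

theorem BiWord.start_ofWord (w : Word) (j : ℕ) : (BiWord.ofWord w).start j = segStart w.1 j := by
  induction j with
  | zero => rfl
  | succ j ih => rw [start_succ, ih, width_ofWord, segStart_succ]

theorem BiWord.toWord_ofWord (w : Word) : (BiWord.ofWord w).toWord = w := by
  refine Subtype.ext (List.ext_getElem (length_toWord _) fun p h1 h2 => ?_)
  have hp : p < (BiWord.ofWord w).n := h2
  obtain ⟨j, hj⟩ := exists_mem_segPos w.2 h2
  have h3 : (BiWord.ofWord w).toWord.1[p] = (BiWord.ofWord w).letter ⟨p, hp⟩ := by simp [toWord]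
  have hr := (BiWord.ofWord w).rank_lt (p := p) (j := j) hj
  have hr' : ((segPos w.1 j).filter (· < p)).card < (segPos w.1 j).card := by
    rwa [(BiWord.ofWord w).length_eq] at hr
  rw [h3, (BiWord.ofWord w).letter_eq (p := ⟨p, hp⟩) (j := j) hj, List.getD_eq_getElem _ _ hr, start_ofWord]
  have h4 : ((BiWord.ofWord w).M j)[(((BiWord.ofWord w).L j).filter (· < p)).card]'hr =
      w.1.getD ((segPos w.1 j).orderEmbOfFin rfl ⟨_, hr'⟩) 0 - segStart w.1 j :=
    List.getElem_ofFn _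
  rw [h4, orderEmbOfFin_card_filter_lt hj hr', List.getD_eq_getElem _ _ h2]
  have := (Finset.mem_filter.1 hj).2.1
  rw [List.getD_eq_getElem _ _ h2] at this
  omega

end OfWord

/-! ### The invariants of the action in terms of words -/

theorem swapSeg_zero_left (p b : ℕ) : swapSeg p 0 b = id := by
  funext v
  unfold swapSeg
  simp only [id]
  split_ifs <;> omega

theorem swapSeg_zero_right (p a : ℕ) : swapSeg p a 0 = id := by
  funext v
  unfold swapSeg
  simp only [id]
  split_ifs <;> omega

theorem swapSeg_add_left (p a a' b v : ℕ) :
    swapSeg p (a + a') b v = swapSeg p a b (swapSeg (p + a) a' b v) := by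
  unfold swapSeg
  split_ifs <;> omega

theorem swapSeg_add_right (p a b b' v : ℕ) :
    swapSeg p a (b + b') v = swapSeg (p + b) a b' (swapSeg p a b v) := by
  unfold swapSeg
  split_ifs <;> omega

section Splitting

variable {l : List ℕ} {p a a' b b' : ℕ}

theorem IsSplit.left_of_add (h : IsSplit l p (a + a') b) (ha : Fits l p (p + a)) :
    IsSplit l (p + a) a' b where
  pos := h.pos
  fits_init := h.fits_init.trans ha (by omega)
  fits_left := by rw [add_assoc]; exact h.fits_left.mono_left (by omega)
  fits_right := by rw [add_assoc p]; exact h.fits_right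

theorem IsSplit.left_of_add' (h : IsSplit l p (a + a') b) (ha : Fits l p (p + a)) :
    IsSplit (l.map (swapSeg (p + a) a' b)) p a b where
  pos := pos_map_swapSeg h.pos
  fits_init := fun j h1 h2 => by
    rw [countLE_map_swapSeg_low _ _ _ _ (by omega), countLE_map_swapSeg_low _ _ _ _ (by omega)]
    exact h.fits_init j h1 h2
  fits_left := fun j h1 h2 => by
    rw [countLE_map_swapSeg_low _ _ _ _ (by omega), countLE_map_swapSeg_low _ _ _ _ (by omega)]
    exact ha j h1 h2
  fits_right := (h.left_of_add ha).swap.fits_left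

theorem IsSplit.right_of_add (h : IsSplit l p a (b + b')) (hb : Fits l (p + a) (p + a + b)) :
    IsSplit l p a b where
  pos := h.pos
  fits_init := h.fits_init
  fits_left := h.fits_left
  fits_right := hb

theorem IsSplit.right_of_add' (h : IsSplit l p a (b + b')) (hb : Fits l (p + a) (p + a + b)) :
    IsSplit (l.map (swapSeg p a b)) (p + b) a b' where
  pos := pos_map_swapSeg h.pos
  fits_init := (h.right_of_add hb).swap.fits_init.trans (h.right_of_add hb).swap.fits_left
    (by omega)
  fits_left := (h.right_of_add hb).swap.fits_right
  fits_right := fun j h1 h2 => by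
    rw [countLE_map_swapSeg_high _ _ _ _ (by omega), countLE_map_swapSeg_high _ _ _ _ (by omega)]
    have := h.fits_right j (by omega) (by omega)
    rw [show p + b + a + b' = p + a + (b + b') by ring]
    exact this

end Splitting

section Invariants

variable {K : Type*} [Field K]

/-- Invariance needs to be checked on the elementary transpositions only. -/
theorem mem_invariants_iff_step {r : ℕ∞} {x : PQSymDual K} : x ∈ invariants K r ↔
    ∀ i, ∀ m : BiWord, wordCoeff x (m.step r i).toWord = wordCoeff x m.toWord := by
  constructor
  · intro h i m
    exact h (BiWord.simpleRefl r i) (Subgroup.subset_closure ⟨i, rfl⟩) m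
  · intro h g hg
    induction hg using Subgroup.closure_induction with
    | mem g hg =>
      obtain ⟨i, rfl⟩ := hg
      exact h i
    | one => exact fun _ => rfl
    | mul g g' _ _ ih ih' => exact fun m => (ih (g' m)).trans (ih' m)
    | inv g _ ih =>
      intro m
      have := ih (g⁻¹ m)
      rw [show g (g⁻¹ m) = m by simp] at this
      exact this.symm

/-- The exchange of two adjacent segments is a composition of exchanges of adjacent columns, one
from each segment. -/
theorem isSwapInvariant_of_columns {r : ℕ∞} {x : PQSymDual K}
    (h : ∀ (l : List ℕ) (k : ℕ), (∀ a ∈ l, 1 ≤ a) →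
      (((countLE l (segStart l (k + 1)) - countLE l (segStart l k) : ℕ) : ℕ∞) < r ∨
        ((countLE l (segStart l (k + 2)) - countLE l (segStart l (k + 1)) : ℕ) : ℕ∞) < r) →
      ev K (l.map (swapSeg (segStart l k) (segWidth l (segStart l k))
        (segWidth l (segStart l (k + 1))))) x = ev K l x) :
    IsSwapInvariant r x := by
  intro l p a b hl hc
  have hle : ∀ {m n : ℕ} {s : ℕ∞}, m ≤ n → (n : ℕ∞) < s → (m : ℕ∞) < s := fun hmn hs =>
    lt_of_le_of_lt (by exact_mod_cast hmn) hs
  induction hn : a + b using Nat.strong_induction_on generalizing l p a b with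
  | _ n ih =>
    subst hn
    rcases Nat.eq_zero_or_pos a with rfl | ha
    · simp [swapSeg_zero_left]
    rcases Nat.eq_zero_or_pos b with rfl | hb
    · simp [swapSeg_zero_right]
    obtain ⟨k, rfl⟩ := exists_segStart_eq l hl.fits_init
    set p := segStart l k with hp
    have hwa : segWidth l p ≤ a := by
      have := hl.fits_left p le_rfl (by omega)
      exact segWidth_le l ha (by omega)
    have hfa := fits_segWidth l p
    have hw1 := one_le_segWidth l p
    obtain ⟨a', ha'⟩ := Nat.exists_eq_add_of_le hwa
    rcases Nat.eq_zero_or_pos a' with rfl | ha0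
    · rw [add_zero] at ha'
      subst ha'
      have hk : segStart l (k + 1) = p + segWidth l p := segStart_succ l k
      have hwb : segWidth l (p + segWidth l p) ≤ b := by
        have := hl.fits_right (p + segWidth l p) le_rfl (by omega)
        exact segWidth_le l hb (by omega)
      have hfb := fits_segWidth l (p + segWidth l p)
      have hw2 := one_le_segWidth l (p + segWidth l p)
      obtain ⟨b', hb'⟩ := Nat.exists_eq_add_of_le hwb
      set c := segWidth l (p + segWidth l p) with hcdef
      rcases Nat.eq_zero_or_pos b' with rfl | hb0
      · -- both segments are columns
        rw [add_zero] at hb'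
        subst hb'
        have hk2 : segStart l (k + 2) = p + segWidth l p + segWidth l (p + segWidth l p) := by
          rw [← hk]
          exact segStart_succ l (k + 1)
        have := h l k hl.pos (by rw [hk, hk2]; exact hc)
        rwa [hk] at this
      · -- the second segment starts with the column of width `c`
        subst hb'
        rw [show l.map (swapSeg p (segWidth l p) (c + b')) =
          (l.map (swapSeg p (segWidth l p) (c))).map
            (swapSeg (p + c) (segWidth l p) b') by
          rw [List.map_map]
          exact List.map_congr_left fun v _ => swapSeg_add_right _ _ _ _ _]
        have e1 := countLE_map_swapSeg_left l p (segWidth l p) (c) le_rfl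
        have e2 := countLE_map_swapSeg_high l p (segWidth l p) (c) le_rfl
        have e3 := countLE_map_swapSeg_high l p (segWidth l p) (c)
          (j := p + segWidth l p + (c + b')) (by omega)
        have m1 := countLE_mono l (show p ≤ p + segWidth l p by omega)
        have m2 := countLE_mono l
          (show p + segWidth l p ≤ p + segWidth l p + c by omega)
        have m3 := countLE_mono l (show p + segWidth l p + c ≤
          p + segWidth l p + (c + b') by omega)
        rw [ih (segWidth l p + b') (by omega) _ _ _ _ (hl.right_of_add' hfb) ?_ rfl,
          ih (segWidth l p + c) (by omega) _ _ _ _ (hl.right_of_add hfb) ?_ rfl]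
        · exact hc.imp (hle (by omega)) (hle (by omega))
        · rw [show p + c + segWidth l p = p + segWidth l p + c by ring, e2,
            show p + segWidth l p + c + b' =
              p + segWidth l p + (c + b') by ring, e3]
          exact hc.imp (hle (by omega)) (hle (by omega))
    · -- the first segment starts with the column of width `segWidth l p`
      subst ha'
      rw [show l.map (swapSeg p (segWidth l p + a') b) =
        (l.map (swapSeg (p + segWidth l p) a' b)).map (swapSeg p (segWidth l p) b) by
          rw [List.map_map]
          exact List.map_congr_left fun v _ => swapSeg_add_left _ _ _ _ _]
      have e1 := countLE_map_swapSeg_left l (p + segWidth l p) a' b le_rfl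
      have e2 := countLE_map_swapSeg_low l (p + segWidth l p) a' b le_rfl
      have e3 := countLE_map_swapSeg_low l (p + segWidth l p) a' b (j := p) (by omega)
      have m1 := countLE_mono l (show p ≤ p + segWidth l p by omega)
      have m2 := countLE_mono l (show p + segWidth l p ≤ p + segWidth l p + a' by omega)
      have m3 := countLE_mono l (show p + segWidth l p + a' ≤ p + segWidth l p + a' + b by omega)
      rw [← add_assoc p] at hc
      rw [ih (segWidth l p + b) (by omega) _ _ _ _ (hl.left_of_add' hfa) ?_ rfl,
        ih (a' + b) (by omega) _ _ _ _ (hl.left_of_add hfa) ?_ rfl]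
      · exact hc.imp (hle (by omega)) (hle (by omega))
      · rw [e2, e3]
        exact hc.imp (hle (by omega)) (hle (by omega))

/-- The elements that are invariant under the `r`-action are those whose realization is unchanged by
the exchange of two adjacent segments, one of which has fewer than `r` cars. -/
theorem mem_invariants_iff {r : ℕ∞} {x : PQSymDual K} :
    x ∈ invariants K r ↔ IsSwapInvariant r x := by
  rw [mem_invariants_iff_step]
  constructor
  · intro h
    refine isSwapInvariant_of_columns fun l k hl hc => ?_
    set m := BiWord.ofWord ⟨l, hl⟩ with hm
    have hw : m.toWord.1 = l := congrArg Subtype.val (BiWord.toWord_ofWord ⟨l, hl⟩)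
    have hs : ∀ j, m.start j = segStart l j := BiWord.start_ofWord ⟨l, hl⟩
    have hwd : ∀ j, m.width j = segWidth l (segStart l j) := BiWord.width_ofWord ⟨l, hl⟩
    have hcard : ∀ j, (m.L j).card = countLE l (segStart l (j + 1)) - countLE l (segStart l j) :=
      fun j => by
        have := m.countLE_start_succ j
        rw [hw, hs, hs] at this
        omega
    have := h k m
    rw [BiWord.step, if_pos (by rw [hcard, hcard]; exact hc), wordCoeff_eq_ev, wordCoeff_eq_ev,
      BiWord.toWord_exchange, hw, hs, hwd, hwd] at this
    exact this
  · intro h i m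
    unfold BiWord.step
    split_ifs with hc
    · rw [wordCoeff_eq_ev, wordCoeff_eq_ev, BiWord.toWord_exchange]
      refine h _ _ _ _ (m.isSplit_toWord i) ?_
      rw [← m.start_succ, ← m.start_succ, m.countLE_start_succ (i + 1), m.countLE_start_succ i,
        Nat.add_sub_cancel_left, Nat.add_sub_cancel_left]
      exact hc
    · rfl

theorem isGradedHopfSubalgebra_invariants (r : ℕ∞) :
    IsGradedHopfSubalgebra K (homogeneous K) (antipodeMap K) (invariants K r) where
  one_mem := mem_invariants_iff.2 (isSwapInvariant_one r)
  mul_mem x hx y hy :=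
    mem_invariants_iff.2 ((mem_invariants_iff.1 hx).mul (mem_invariants_iff.1 hy))
  comul_mem x hx := mem_range_mapIncl
    (fun _ hb => mem_invariants_iff.2 ((mem_invariants_iff.1 hx).sliceRight_comul hb))
    (fun _ ha => mem_invariants_iff.2 ((mem_invariants_iff.1 hx).sliceLeft_comul ha))
  antipode_mem x hx := antipodeMap_mem (mem_invariants_iff.2 (isSwapInvariant_one r))
    (fun x hx y hy =>
      mem_invariants_iff.2 ((mem_invariants_iff.1 hx).mul (mem_invariants_iff.1 hy)))
    (fun x hx => mem_range_mapIncl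
      (fun _ hb => mem_invariants_iff.2 ((mem_invariants_iff.1 hx).sliceRight_comul hb))
      (fun _ ha => mem_invariants_iff.2 ((mem_invariants_iff.1 hx).sliceLeft_comul ha)))
    (fun x hx n => mem_invariants_iff.2 ((mem_invariants_iff.1 hx).homogeneousProj n)) hx
  graded := by
    refine le_antisymm (fun x hx => ?_) (iSup_le fun n => inf_le_left)
    obtain ⟨N, hN⟩ := exists_sum_homogeneousProj x
    rw [hN]
    exact Submodule.sum_mem _ fun n _ => Submodule.mem_iSup_of_mem n
      ⟨mem_invariants_iff.2 ((mem_invariants_iff.1 hx).homogeneousProj n), homogeneousProj_mem n x⟩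

end Invariants

end PQSym

theorem mainTheorem1 (K : Type*) [Field K] [CharZero K] :
    ∃ S : PQSym.PQSymDual K →ₗ[K] PQSym.PQSymDual K,
      PQSym.IsHopfAlgebra K S ∧
      PQSym.IsHopfGrading K (PQSym.homogeneous K) S ∧
      PQSym.invariants K 1 = ⊤ ∧
      (∀ r s : ℕ∞, 1 ≤ r → r ≤ s → PQSym.invariants K s ≤ PQSym.invariants K r) ∧
      (∀ r : ℕ∞, 1 ≤ r →
        PQSym.IsGradedHopfSubalgebra K (PQSym.homogeneous K) S (PQSym.invariants K r)) ∧
      (∀ r : ℕ∞, 1 ≤ r →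
        ∃ x ∈ PQSym.invariants K r, ∃ y ∈ PQSym.invariants K r, x * y ≠ y * x) ∧
      (∀ r : ℕ∞, 1 ≤ r → r ≠ ⊤ → ∃ x ∈ PQSym.invariants K r,
        TensorProduct.comm K _ _ (CoalgebraStruct.comul (R := K) x) ≠
          CoalgebraStruct.comul (R := K) x) ∧
      (∀ x ∈ PQSym.invariants K ⊤,
        TensorProduct.comm K _ _ (CoalgebraStruct.comul (R := K) x) =
          CoalgebraStruct.comul (R := K) x) := by
  refine ⟨PQSym.antipodeMap K, PQSym.isHopfAlgebra_antipodeMap, PQSym.isHopfGrading_homogeneous,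
    ?_, ?_, fun r _ => PQSym.isGradedHopfSubalgebra_invariants r, ?_, ?_, ?_⟩
  · exact eq_top_iff.2 fun x _ => PQSym.mem_invariants_iff.2 (PQSym.isSwapInvariant_one_right x)
  · exact fun r s _ hrs x hx =>
      PQSym.mem_invariants_iff.2 ((PQSym.mem_invariants_iff.1 hx).anti hrs)
  · exact fun r _ =>
      ⟨_, PQSym.mem_invariants_iff.2 (PQSym.isSwapInvariant_basis_onesPF r 1),
        _, PQSym.mem_invariants_iff.2 (PQSym.isSwapInvariant_basis_onesPF r 2),
        PQSym.basis_onesPF_not_commute⟩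
  · intro r hr hr'
    lift r to ℕ using hr'
    have hr1 : 1 ≤ r := by exact_mod_cast hr
    refine ⟨PQSym.G K (PQSym.twoColumnsPF r (r + 1)), PQSym.mem_invariants_iff.2
      (PQSym.isSwapInvariant_basis_of_count fun v hv => ?_),
      PQSym.comm_comul_basis_twoColumnsPF_ne hr1⟩
    exact PQSym.le_count_twoColumnsPF r v hv
  · exact fun x hx => (PQSym.mem_invariants_iff.1 hx).comm_comul
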